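/- **Setting.** Let $a,b,c,d,A\in\mathbb R$ with $d\neq 0,1$ and $4A/d\le (1-a)^2$, and consider the Heun-type equation $$y''+\Big(\frac ax+\frac b{x-1}+\frac c{x-d}\Big)y'+\frac1{x(x-1)(x-d)}\Big[\frac Ax+\frac B{x-1}+\frac C{x-d}+xD-E\Big]y=0\qquad(\ast)$$ with $D=0$, $4C=cd(1-d)(2-c)$ and $E=\frac Ad-\frac B{1-d}-\frac c2\big[d(a+b+c-2)+1-a-\frac c2\big]$. Put $\nu=\sqrt{(1-a)^2-4A/d}$, $2\sigma=\nu+1$, $2\tau=|a+b+c-1|$, and, for $B$ with $4B/(1-d)<(1-b)^2$, put $\mu=\sqrt{(1-b)^2-4B/(1-d)}-1>-1$ and $2\gamma=\mu+1$. Let $$F_n=\frac{\nu^2-\mu^2}{(2n+\mu+\nu)(2n+\mu+\nu+2)}\quad\Big(F_0=\frac{\nu-\mu}{\mu+\nu+2}\Big),\qquad G_n=\frac1{2n+\mu+\nu+2}\sqrt{\frac{(n+1)(n+\mu+1)(n+\nu+1)(n+\mu+\nu+1)}{(2n+\mu+\nu+1)(2n+\mu+\nu+3)}},$$ and consider the recursion,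 for $n=0,1,2,\dots$ (without the $f_{n-1}$ term, and with $\frac{n(n+\nu)}{2n+\mu+\nu}$ read as $0$, when $n=0$) $$0=\Big\{\tfrac{n(n+\nu)}{2n+\mu+\nu}+\tfrac12(F_n-1)\big[(n+\tfrac{\mu+\nu}2+1)^2-\tau^2\big]\Big\}f_n+G_{n-1}\big[(n+\tfrac{\mu+\nu}2)^2-\tau^2\big]f_{n-1}+G_n\big[(n+\tfrac{\mu+\nu}2+1)^2-\tau^2\big]f_{n+1}.\qquad(\ast\ast)$$ Let $W_n$ denote the normalized Wilson polynomial $$W_n(z^2;\sigma-\tau,\sigma+\tau,\gamma,\gamma)=\sqrt{\frac{2n+2\sigma+2\gamma-1}{n+2\sigma+2\gamma-1}\,\frac{(2\sigma)_n(2\sigma+2\gamma)_n}{(2\gamma)_n\,n!}}\;\frac{(\sigma-\tau+\gamma)_n}{(\sigma+\tau+\gamma)_n}\;{}_4F_3\!\left(\begin{matrix}-n,\;n+2\sigma+2\gamma-1,\;\sigma-\tau+iz,\;\sigma-\tau-iz\\2\sigma,\;\sigma-\tau+\gamma,\;\sigma-\tau+\gamma\end{matrix}\,\middle|\,1\right),$$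 the terminating series being stopped at the first vanishing numerator factor. Let $\phi_n(x)=c_n|x|^\alpha|x-1|^\beta|x-d|^{-c/2}P_n^{(\mu,\nu)}(x)$ with $2\alpha=\nu+1-a$, $2\beta=\mu+2-b$, $$P^{(\mu,\nu)}_n(x)=\tfrac{\Gamma(n+\mu+1)}{\Gamma(n+1)\Gamma(\mu+1)}\,{}_2F_1(-n,n+\mu+\nu+1;\mu+1;1-x),\qquad c_n=\sqrt{(2n+\mu+\nu+1)\tfrac{\Gamma(n+1)\Gamma(n+\mu+\nu+1)}{\Gamma(n+\mu+1)\Gamma(n+\nu+1)}}.$$ **Claim.** 1. For every $B$ with $4B/(1-d)<(1-b)^2$, $f_n=W_n(z^2;\sigma-\tau,\sigma+\tau,\gamma,\gamma)$ with $z^2=-\frac14(\mu+1)^2$ solves $(\ast\ast)$ with $f_0=1$, and every square-summable solution of $(\ast\ast)$ is a multiple of it. 2. The spectrum, that is the set of all $B$ with $4B/(1-d)<(1-b)^2$ for which $(\ast\ast)$ has a nonzero square-summable solution, is finite. It consists exactly of the pairwise distinct values $B_k$, $k=0,1,2,\dots$, $k<\tau-\sigma$, given by $$\frac{4B_k}{1-d}=(1-b)^2-\Big(2k+1-|a+b+c-1|+\sqrt{(1-a)^2-4A/d}\Big)^2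 .$$ 3. Let $k<\tau-\sigma$, $B=B_k$ (with $\mu,\gamma,\phi_n$ formed with this $B$), let $N=\lfloor\tau-\sigma\rfloor$ and $z_j^2=-(j+\sigma-\tau)^2$. Then $4B_k/(1-d)<(1-b)^2$, $-\frac14(\mu+1)^2=z_k^2$, $k\le N$, and $W_n(z_k^2;\sigma-\tau,\sigma+\tau,\gamma,\gamma)=0$ for $n>k$. Put $$q^2(j)=-2\,\frac{\Gamma(2\sigma+2\gamma)\Gamma(2\tau)\Gamma(\gamma-\sigma+\tau)^2}{\Gamma(2\tau-2\sigma+1)\Gamma(2\gamma)\Gamma(\gamma+\sigma+\tau)^2}\left\{(j+\sigma-\tau)\frac{(2\sigma-2\tau)_j(2\sigma)_j[(\sigma-\tau+\gamma)_j]^2}{(1-2\tau)_j[(\sigma-\tau-\gamma+1)_j]^2\,j!}\right\}.$$ Then $q^2(j)>0$ for $j\le k$, $q^2(j)=0$ for $k<j\le N$, and $q^2$ is the discrete weight of the Wilson polynomials: for all $n,m\le k$, $$\sum_{j=0}^Nq^2(j)\,W_n(z_j^2;\sigma-\tau,\sigma+\tau,\gamma,\gamma)\,W_m(z_j^2;\sigma-\tau,\sigma+\tau,\gamma,\gamma)=\delta_{nm}.$$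 With $q(k)=\sqrt{q^2(k)}$, the function $$y_k(x)=q(k)\sum_{n=0}^NW_n(z_k^2;\sigma-\tau,\sigma+\tau,\gamma,\gamma)\,\phi_n(x)$$ does not vanish identically on $(0,1)\setminus\{d\}$, is twice continuously differentiable on $\mathbb R\setminus\{0,1,d\}$ and solves $(\ast)$ there for $B=B_k$ and $E=E_k$. Equivalently $Hy_k=E_ky_k$, where $H$ (with $B=B_k$) is defined by writing the operator on the left of $(\ast)$, multiplied by $x(x-1)(x-d)$, as $H-E$. Here $E_k$ is the value of $E$ stated above for $B=B_k$, namely $$4E_k=\frac{4A}d-2c\Big[d(a+b+c-2)+1-a-\frac c2\Big]-(1-b)^2+\Big(2k+1-|a+b+c-1|+\sqrt{(1-a)^2-4A/d}\Big)^2 .$$ -/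

import Mathlib

open scoped Nat

noncomputable section

namespace HeunRestricted

/-- The Pochhammer symbol `(x)_n = x (x + 1) ⋯ (x + n - 1)`. -/
def poch (x : ℝ) (n : ℕ) : ℝ := (ascPochhammer ℝ n).eval x

/-- The generalized hypergeometric series `₄F₃(a₁, a₂, a₃, a₄; b₁, b₂, b₃ | x)`. -/
def hyp4F3 (a₁ a₂ a₃ a₄ b₁ b₂ b₃ x : ℂ) : ℂ :=
  ∑' j : ℕ, (ascPochhammer ℂ j).eval a₁ * (ascPochhammer ℂ j).eval a₂ *
      (ascPochhammer ℂ j).eval a₃ * (ascPochhammer ℂ j).eval a₄ /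
    ((ascPochhammer ℂ j).eval b₁ * (ascPochhammer ℂ j).eval b₂ * (ascPochhammer ℂ j).eval b₃) *
      (x ^ j / (j ! : ℂ))

/-- The value `₄F₃(-n, n + a + b + c + d - 1, a + i z, a - i z; a + b, a + c, a + d | 1)` as a
function of `t = z²`; here `(a + i z)_j (a - i z)_j = ∏_{i < j} ((a + i)² + z²)`. See
`hyp4F3_eq_wilsonHyp`. A term whose numerator vanishes counts as zero, so that the series stops
at the first vanishing numerator factor. -/
def wilsonHyp (n : ℕ) (t a b c d : ℝ) : ℝ :=
  ∑ j ∈ Finset.range (n + 1),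
    poch (-(n : ℝ)) j * poch (n + a + b + c + d - 1) j *
        (∏ i ∈ Finset.range j, ((a + i) ^ 2 + t)) /
      (poch (a + b) j * poch (a + c) j * poch (a + d) j) * (1 / (j ! : ℝ))

/-- The normalized Wilson polynomial `W_n(t; a, b, c, d)`, `t = z²`, for four general parameters,
with the nonnegative square root. -/
def wilsonNormalized (n : ℕ) (t a b c d : ℝ) : ℝ :=
  √((2 * n + a + b + c + d - 1) / (n + a + b + c + d - 1) *
      (poch (a + b) n * poch (a + c) n * poch (a + d) n * poch (a + b + c + d) n /
        (poch (b + c) n * poch (b + d) n * poch (c + d) n * (n ! : ℝ)))) *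
    wilsonHyp n t a b c d

/-- The normalized Wilson polynomial `W_n(t; σ - τ, σ + τ, g, g)`, `t = z²`. Because the last two
parameters agree, the factor `((σ - τ + g)_n / (σ + τ + g)_n)²` below the square root in the
normalization is a perfect square; it is extracted as `(σ - τ + g)_n / (σ + τ + g)_n`, without
absolute value. This differs from `wilsonNormalized` by the sign of `(σ - τ + g)_n` only, see
`wilson_eq_sign_mul`. -/
def wilson (n : ℕ) (t σ τ g : ℝ) : ℝ :=
  √((2 * n + 2 * σ + 2 * g - 1) / (n + 2 * σ + 2 * g - 1) *
      (poch (2 * σ) n * poch (2 * σ + 2 * g) n / (poch (2 * g) n * (n ! : ℝ)))) *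
    (poch (σ - τ + g) n / poch (σ + τ + g) n) *
    wilsonHyp n t (σ - τ) (σ + τ) g g

/-- The discrete weight `q²(k)` of the Wilson polynomial `W_n(z²; σ - τ, σ + τ, g, g)`. -/
def qSq (k : ℕ) (σ τ g : ℝ) : ℝ :=
  -2 * (Real.Gamma (2 * σ + 2 * g) * Real.Gamma (2 * τ) * Real.Gamma (g - σ + τ) ^ 2 /
      (Real.Gamma (2 * τ - 2 * σ + 1) * Real.Gamma (2 * g) * Real.Gamma (g + σ + τ) ^ 2)) *
    ((k + σ - τ) *
      (poch (2 * σ - 2 * τ) k * poch (2 * σ) k * poch (σ - τ + g) k ^ 2 /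
        (poch (1 - 2 * τ) k * poch (σ - τ - g + 1) k ^ 2 * (k ! : ℝ))))

/-- The spectrum formula `z_k² = -(k + σ - τ)²`. -/
def zSq (k : ℕ) (σ τ : ℝ) : ℝ := -(k + σ - τ) ^ 2

/-- The Jacobi polynomial `P_n^{(μ, ν)}(x)` on `[0, 1]`. -/
def jacobiP (n : ℕ) (μ ν x : ℝ) : ℝ :=
  Real.Gamma (n + μ + 1) / (Real.Gamma (n + 1) * Real.Gamma (μ + 1)) *
    ordinaryHypergeometric (-(n : ℝ)) (n + μ + ν + 1) (μ + 1) (1 - x)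

/-- The normalization constant `c_n` of the Jacobi polynomial. -/
def jacobiNorm (n : ℕ) (μ ν : ℝ) : ℝ :=
  √((2 * n + μ + ν + 1) * (Real.Gamma (n + 1) * Real.Gamma (n + μ + ν + 1) /
    (Real.Gamma (n + μ + 1) * Real.Gamma (n + ν + 1))))

/-- The basis function `φ_n(x) = c_n |x|^α |x - 1|^β |x - d|^γ P_n^{(μ, ν)}(x)`. On each interval
between the singular points, the absolute values change the powers by a constant phase only. -/
def phi (n : ℕ) (α β γ d μ ν x : ℝ) : ℝ :=
  jacobiNorm n μ ν * |x| ^ α * |x - 1| ^ β * |x - d| ^ γ * jacobiP n μ ν x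

/-- The coefficient `F_n`; at `n = 0` the common factor `μ + ν` is cancelled. -/
def coeffF (n : ℕ) (μ ν : ℝ) : ℝ :=
  if n = 0 then (ν - μ) / (μ + ν + 2)
  else (ν ^ 2 - μ ^ 2) / ((2 * n + μ + ν) * (2 * n + μ + ν + 2))

/-- The coefficient `G_n`. -/
def coeffG (n : ℕ) (μ ν : ℝ) : ℝ :=
  1 / (2 * n + μ + ν + 2) *
    √((n + 1) * (n + μ + 1) * (n + ν + 1) * (n + μ + ν + 1) /
      ((2 * n + μ + ν + 1) * (2 * n + μ + ν + 3)))

/-- `f` solves the symmetric three-term recursion relation of the restricted solution, for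
`n = 0, 1, 2, …`, where `s = a + b + c - 1`; there is no `f_{n-1}` term at `n = 0`. -/
def SolvesRecursion (μ ν s : ℝ) (f : ℕ → ℝ) : Prop :=
  ∀ n : ℕ,
    0 = (n * (n + ν) / (2 * n + μ + ν) +
          1 / 2 * (coeffF n μ ν - 1) * ((n + (μ + ν) / 2 + 1) ^ 2 - 1 / 4 * s ^ 2)) * f n +
        (if n = 0 then 0 else
          coeffG (n - 1) μ ν * ((n + (μ + ν) / 2) ^ 2 - 1 / 4 * s ^ 2) * f (n - 1)) +
        coeffG n μ ν * ((n + (μ + ν) / 2 + 1) ^ 2 - 1 / 4 * s ^ 2) * f (n + 1)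

/-- `ν = √((1 - a)² - 4 A / d)`. -/
def nuPar (a d A : ℝ) : ℝ := √((1 - a) ^ 2 - 4 * A / d)

/-- `μ`, where `μ + 1 = √((1 - b)² - 4 B / (1 - d))`. -/
def muPar (b d B : ℝ) : ℝ := √((1 - b) ^ 2 - 4 * B / (1 - d)) - 1

/-- `2 σ = ν + 1`. -/
def sigmaPar (a d A : ℝ) : ℝ := (nuPar a d A + 1) / 2

/-- `2 τ = |a + b + c - 1|`. -/
def tauPar (a b c : ℝ) : ℝ := |a + b + c - 1| / 2

/-- The Wilson parameter `γ`, `2 γ = μ + 1`. -/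
def gammaPar (b d B : ℝ) : ℝ := (muPar b d B + 1) / 2

/-- The largest integer `N ≤ τ - σ`. -/
def sizeN (a b c d A : ℝ) : ℕ := ⌊tauPar a b c - sigmaPar a d A⌋₊

/-- The value of `E` required in the restricted case. -/
def restrictedE (a b c d A B : ℝ) : ℝ :=
  A / d - B / (1 - d) - c / 2 * (d * (a + b + c - 2) + 1 - a - c / 2)

/-- The quantized value `B_k` of `B`. -/
def quantizedB (a b c d A : ℝ) (k : ℕ) : ℝ :=
  (1 - d) / 4 * ((1 - b) ^ 2 -
    (2 * k + 1 - |a + b + c - 1| + √((1 - a) ^ 2 - 4 * A / d)) ^ 2)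

/-- The eigenvalue `E_k`. -/
def quantizedE (a b c d A : ℝ) (k : ℕ) : ℝ :=
  1 / 4 * (4 * A / d - 2 * c * (d * (a + b + c - 2) + 1 - a - c / 2) - (1 - b) ^ 2 +
    (2 * k + 1 - |a + b + c - 1| + √((1 - a) ^ 2 - 4 * A / d)) ^ 2)

/-- The values of `B`, with `4 B / (1 - d) < (1 - b)²` (that is, `μ > -1`), for which the recursion
has a nonzero square-summable solution. -/
def spectrumB (a b c d A : ℝ) : Set ℝ :=
  {B | 4 * B / (1 - d) < (1 - b) ^ 2 ∧
    ∃ f : ℕ → ℝ, f ≠ 0 ∧ Summable (fun n => f n ^ 2) ∧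
      SolvesRecursion (muPar b d B) (nuPar a d A) (a + b + c - 1) f}

/-- `y` satisfies the nine-parameter Heun-type equation away from its singular points. -/
def IsHeunSolution (a b c d A B C D E : ℝ) (y : ℝ → ℝ) : Prop :=
  ∀ x : ℝ, x ≠ 0 → x ≠ 1 → x ≠ d →
    ContDiffAt ℝ 2 y x ∧
    deriv (deriv y) x + (a / x + b / (x - 1) + c / (x - d)) * deriv y x +
      1 / (x * (x - 1) * (x - d)) *
        (A / x + B / (x - 1) + C / (x - d) + x * D - E) * y x = 0

/-- The operator `H`, where `x (x - 1) (x - d) 𝒟 = H - E` and the Heun-type equation reads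
`𝒟 y = 0`. -/
def heunH (a b c d A B C D : ℝ) (y : ℝ → ℝ) (x : ℝ) : ℝ :=
  x * (x - 1) * (x - d) *
      (deriv (deriv y) x + (a / x + b / (x - 1) + c / (x - d)) * deriv y x) +
    (A / x + B / (x - 1) + C / (x - d) + x * D) * y x

/-- The function
`y_k(x) = q(k) ∑_{n = 0}^{N} W_n(z_k²; σ - τ, σ + τ, γ, γ) φ_n(x)` for `B = B_k`, with the basis
parameters `2 α = ν + 1 - a`, `2 β = μ + 2 - b` and the exponent `-c / 2` at `d`. -/
def ySol (a b c d A : ℝ) (k : ℕ) (x : ℝ) : ℝ :=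
  √(qSq k (sigmaPar a d A) (tauPar a b c) (gammaPar b d (quantizedB a b c d A k))) *
    ∑ n ∈ Finset.range (sizeN a b c d A + 1),
      wilson n (zSq k (sigmaPar a d A) (tauPar a b c)) (sigmaPar a d A) (tauPar a b c)
          (gammaPar b d (quantizedB a b c d A k)) *
        phi n ((nuPar a d A + 1 - a) / 2) ((muPar b d (quantizedB a b c d A k) + 2 - b) / 2)
          (-c / 2) d (muPar b d (quantizedB a b c d A k)) (nuPar a d A) x

/-- `wilsonHyp` is the terminating series `₄F₃` at `1`. -/
theorem hyp4F3_eq_wilsonHyp (n : ℕ) (z : ℂ) (t a b c d : ℝ) (hz : z ^ 2 = (t : ℂ)) :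
    hyp4F3 (-(n : ℂ)) (n + a + b + c + d - 1) (a + Complex.I * z) (a - Complex.I * z)
      (a + b) (a + c) (a + d) 1 = (wilsonHyp n t a b c d : ℂ) := by
  have hp : ∀ (x : ℝ) (j : ℕ), ((poch x j : ℝ) : ℂ) = (ascPochhammer ℂ j).eval (x : ℂ) := by
    intro x j
    have h := Polynomial.eval₂_at_apply (p := ascPochhammer ℝ j) Complex.ofRealHom x
    rw [← Polynomial.eval_map, ascPochhammer_map] at h
    simpa [poch] using h.symm
  have hprod : ∀ j : ℕ, (ascPochhammer ℂ j).eval ((a : ℂ) + Complex.I * z) *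
      (ascPochhammer ℂ j).eval ((a : ℂ) - Complex.I * z) =
        ∏ i ∈ Finset.range j, (((a : ℂ) + i) ^ 2 + t) := by
    intro j
    induction j with
    | zero => simp
    | succ j ih =>
      rw [Finset.prod_range_succ, ← ih, ascPochhammer_succ_eval, ascPochhammer_succ_eval, ← hz]
      linear_combination (-(ascPochhammer ℂ j).eval ((a : ℂ) + Complex.I * z) *
        (ascPochhammer ℂ j).eval ((a : ℂ) - Complex.I * z) * z ^ 2) * Complex.I_sq
  unfold hyp4F3 wilsonHyp
  rw [tsum_eq_sum (s := Finset.range (n + 1))]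
  · push_cast
    refine Finset.sum_congr rfl fun j _ => ?_
    simp only [hp]
    push_cast
    rw [← hprod j, one_pow]
    ring
  · intro j hj
    have h0 : (ascPochhammer ℂ j).eval (-(n : ℂ)) = 0 := by
      rw [ascPochhammer_eval_neg_eq_descPochhammer, descPochhammer_eval_eq_descFactorial,
        Nat.descFactorial_of_lt (by simpa using hj)]
      simp
    simp [h0]

/-- `wilson` is `wilsonNormalized` up to the sign of `(σ - τ + g)_n`. -/
theorem wilson_eq_sign_mul (n : ℕ) (t σ τ g : ℝ) (hσ : 0 < σ) (hτ : 0 ≤ τ) (hg : 0 < g) :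
    wilson n t σ τ g =
      (SignType.sign (poch (σ - τ + g) n) : ℝ) *
        wilsonNormalized n t (σ - τ) (σ + τ) g g := by
  have hv : 0 < poch (σ + τ + g) n := ascPochhammer_pos n _ (by positivity)
  have key : (2 * (n : ℝ) + (σ - τ) + (σ + τ) + g + g - 1) /
        (n + (σ - τ) + (σ + τ) + g + g - 1) *
      (poch ((σ - τ) + (σ + τ)) n * poch (σ - τ + g) n * poch (σ - τ + g) n *
          poch ((σ - τ) + (σ + τ) + g + g) n /
        (poch (σ + τ + g) n * poch (σ + τ + g) n * poch (g + g) n * (n ! : ℝ))) =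
      ((2 * n + 2 * σ + 2 * g - 1) / (n + 2 * σ + 2 * g - 1) *
        (poch (2 * σ) n * poch (2 * σ + 2 * g) n / (poch (2 * g) n * (n ! : ℝ)))) *
      (poch (σ - τ + g) n / poch (σ + τ + g) n) ^ 2 := by
    have e1 : (σ - τ) + (σ + τ) = 2 * σ := by ring
    have e2 : (σ - τ) + (σ + τ) + g + g = 2 * σ + 2 * g := by ring
    have e3 : 2 * (n : ℝ) + (σ - τ) + (σ + τ) + g + g - 1 = 2 * n + 2 * σ + 2 * g - 1 := by ring
    have e4 : (n : ℝ) + (σ - τ) + (σ + τ) + g + g - 1 = n + 2 * σ + 2 * g - 1 := by ring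
    have e5 : g + g = 2 * g := by ring
    rw [e2, e1, e3, e4, e5]
    ring
  unfold wilson wilsonNormalized
  rw [key, Real.sqrt_mul' _ (sq_nonneg _), Real.sqrt_sq_eq_abs, abs_div, abs_of_pos hv]
  have hs := sign_mul_abs (poch (σ - τ + g) n)
  conv_lhs => rw [← hs]
  ring

end HeunRestricted

end

open scoped Nat

namespace HeunRestricted

/-! The recursion has a positive explicit solution `wilsonEnd`, independent of $\tau$. Writing
$f_n=\chi_n\cdot$`wilsonEnd n`, the recursion says that a discrete flux is conserved. There is no
term below $n=0$, so the flux is zero, and the recursion is equivalent to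
$(\sigma-\tau+\gamma+n)(\sigma+\tau+\gamma+n)(\chi_{n+1}-\chi_n)=0$ for all $n$
(`solvesRecursion_iff`). The square of `wilsonEnd` is bounded below by a harmonic term, so no
nonzero multiple is square-summable, even on a tail. Hence a nonzero square-summable solution needs
the chain to break: $\sigma-\tau+\gamma=-k$ for some natural $k$. The solution is then `wilsonEnd`
up to $n=k$ and zero beyond (`exists_summable_iff`). Solving for $B$ gives the spectrum, with
$k<\tau-\sigma$ because $\gamma>0$.

At $z^2=-\gamma^2$ one numerator parameter of the ${}_4F_3$ cancels a denominator parameter, and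
Saalschütz sums the remaining balanced ${}_3F_2$. So the Wilson polynomial there is `wilsonEnd`,
truncated by its factor $(\sigma-\tau+\gamma)_n$ (`wilson_end`, `wilson_eq_zero`).

For the orthogonality, the moments of the weight against products of the two families
$\prod_l((c+l)^2+z_j^2)$, $c=\sigma\mp\tau$, obey first-order recursions that come from telescoping
(`racahSum_telescope`). A second use of Saalschütz shows that the polynomial of degree $n$
annihilates lower degrees (`wilson_moment`, `wilson_moment_mixed`); the total mass is read off from
an extreme moment with only one term.

Finally, `wilsonEnd n` is proportional to $c_nP_n^{(\mu,\nu)}(1)$, so $y_k$ is a Christoffel–Darboux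
sum at an endpoint and collapses to the prefactor times one Jacobi polynomial of degree $k$ with
$\mu$ raised by one (`jacobi_kernel`). Conjugating $(\ast)$ by the prefactor removes the singularity
at $d$ and leaves the equation of exactly this polynomial (`isHeunSolution_prefactor_mul`). -/

/-! ### Pochhammer symbols and the Pfaff–Saalschütz sum. -/

theorem poch_zero (x : ℝ) : poch x 0 = 1 := by simp [poch]

theorem poch_succ (x : ℝ) (n : ℕ) : poch x (n + 1) = poch x n * (x + n) := by
  simp [poch, ascPochhammer_succ_eval]

theorem poch_succ_left (x : ℝ) (n : ℕ) : poch x (n + 1) = x * poch (x + 1) n := by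
  induction n generalizing x with
  | zero => simp [poch_succ, poch_zero]
  | succ n ih => rw [poch_succ, ih, poch_succ (x + 1)]; push_cast; ring

theorem poch_add (x : ℝ) (m n : ℕ) : poch x (m + n) = poch x m * poch (x + m) n := by
  induction n with
  | zero => simp [poch_zero]
  | succ n ih => rw [← add_assoc, poch_succ, ih, poch_succ]; push_cast; ring

theorem poch_eq_prod (x : ℝ) (n : ℕ) : poch x n = ∏ i ∈ Finset.range n, (x + i) := by
  induction n with
  | zero => simp [poch_zero]
  | succ n ih => rw [poch_succ, ih, Finset.prod_range_succ]

theorem poch_pos {x : ℝ} (hx : 0 < x) (n : ℕ) : 0 < poch x n := ascPochhammer_pos n x hx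

theorem poch_ne_zero_iff (x : ℝ) (n : ℕ) : poch x n ≠ 0 ↔ ∀ i < n, x + i ≠ 0 := by
  simp [poch_eq_prod, Finset.prod_ne_zero_iff]

theorem poch_eq_zero_iff (x : ℝ) (n : ℕ) : poch x n = 0 ↔ ∃ i < n, x + i = 0 := by
  simp [poch_eq_prod, Finset.prod_eq_zero_iff]

theorem poch_neg_nat_eq_zero {k n : ℕ} (h : k < n) : poch (-(k : ℝ)) n = 0 :=
  (poch_eq_zero_iff _ _).2 ⟨k, h, by ring⟩

theorem poch_reflect (x : ℝ) (n : ℕ) : poch (1 - x - n) n = (-1) ^ n * poch x n := by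
  induction n generalizing x with
  | zero => simp [poch_zero]
  | succ n ih =>
    rw [poch_succ_left, poch_succ]
    have := ih x
    rw [show (1 - x - ((n + 1 : ℕ) : ℝ) + 1) = 1 - x - n by push_cast; ring, this]
    push_cast; ring

theorem poch_neg_nat (n j : ℕ) : poch (-(n : ℝ)) j * (1 / (j ! : ℝ)) = (-1) ^ j * n.choose j := by
  have hj : (j ! : ℝ) ≠ 0 := by positivity
  have h : poch (-(n : ℝ)) j = (-1) ^ j * (n.descFactorial j : ℝ) := by
    rw [poch, ascPochhammer_eval_neg_eq_descPochhammer, descPochhammer_eval_eq_descFactorial]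
  rw [h, Nat.descFactorial_eq_factorial_mul_choose]
  push_cast
  field_simp

theorem Gamma_add_nat {x : ℝ} (hx : 0 < x) (n : ℕ) :
    Real.Gamma (x + n) = poch x n * Real.Gamma x := by
  induction n with
  | zero => simp [poch_zero]
  | succ n ih =>
    rw [poch_succ, Nat.cast_succ, ← add_assoc, Real.Gamma_add_one (by positivity), ih]; ring

/-- The Pfaff–Saalschütz sum with cleared denominators. -/
theorem saalschutz (n : ℕ) (a b c e : ℝ) (h : c + e + n = a + b + 1) :
    ∑ j ∈ Finset.range (n + 1), (-1) ^ j * (n.choose j : ℝ) * (poch a j * poch b j) *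
      (poch (c + j) (n - j) * poch (e + j) (n - j)) =
        (-1) ^ n * (poch (c - a) n * poch (c - b) n) := by
  induction n generalizing a b c e with
  | zero => simp [poch_zero]
  | succ n ih =>
    have h1 := ih a b c (e + 1) (by push_cast at h; linarith)
    have h2 := ih (a + 1) (b + 1) (c + 1) (e + 1 + 1) (by push_cast at h; linarith)
    -- A contiguous relation holds term by term, by Pascal's rule together with $(j+1)\binom
    -- n{j+1}=(n-j)\binom nj$. The balance condition passes to both shifted sums; on the right-hand
    -- side it enters as $(c+n)e-ab=-(c-a+n)(c-b+n)$.
    have key : ∀ j ∈ Finset.range (n + 1),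
        (-1) ^ (j + 1) * ((n + 1).choose (j + 1) : ℝ) * (poch a (j + 1) * poch b (j + 1)) *
          (poch (c + (j + 1 : ℕ)) (n + 1 - (j + 1)) * poch (e + (j + 1 : ℕ)) (n + 1 - (j + 1))) =
        (c + n) * e * ((-1) ^ (j + 1) * (n.choose (j + 1) : ℝ) * (poch a (j + 1) * poch b (j + 1)) *
          (poch (c + (j + 1 : ℕ)) (n - (j + 1)) * poch (e + 1 + (j + 1 : ℕ)) (n - (j + 1)))) -
        a * b * ((-1) ^ j * (n.choose j : ℝ) * (poch (a + 1) j * poch (b + 1) j) *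
          (poch (c + 1 + j) (n - j) * poch (e + 1 + 1 + j) (n - j))) := by
      intro j hj
      have hjn : j ≤ n := by simpa [Nat.lt_succ_iff] using hj
      rcases hjn.eq_or_lt with rfl | hlt
      · simp [poch_zero, poch_succ_left]; ring
      · obtain ⟨m, rfl⟩ := Nat.exists_eq_add_of_lt hlt
        have hch := Nat.choose_succ_right_eq (j + m + 1) j
        have hch' : ((j + m + 1).choose (j + 1) : ℝ) * (j + 1) =
            (j + m + 1).choose j * (m + 1) := by
          rw [show j + m + 1 - j = m + 1 by omega] at hch; exact_mod_cast hch
        rw [show j + m + 1 + 1 - (j + 1) = m + 1 by omega, show j + m + 1 - (j + 1) = m by omega,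
          show j + m + 1 - j = m + 1 by omega, Nat.choose_succ_succ, poch_succ_left a,
          poch_succ_left b, poch_succ (c + (j + 1 : ℕ)), poch_succ (c + 1 + j),
          poch_succ_left (e + (j + 1 : ℕ)), poch_succ (e + 1 + 1 + j)]
        push_cast
        rw [show c + 1 + (j : ℝ) = c + (j + 1) by ring, show e + (j + 1 : ℝ) + 1 = e + 1 + 1 + j by ring,
          show e + 1 + (j + 1 : ℝ) = e + 1 + 1 + j by ring]
        linear_combination (-1) ^ (j + 1) * a * b * poch (a + 1) j * poch (b + 1) j *
          poch (c + (j + 1)) m * (c + (j + 1) + m) * poch (e + 1 + 1 + j) m * hch'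
    rw [Finset.sum_range_succ', Finset.sum_congr rfl key, Finset.sum_sub_distrib, ← Finset.mul_sum,
      ← Finset.mul_sum, h2]
    rw [Finset.sum_range_succ'] at h1
    have h3 : ∑ j ∈ Finset.range (n + 1), ((-1) ^ (j + 1) * (n.choose (j + 1) : ℝ) *
        (poch a (j + 1) * poch b (j + 1)) * (poch (c + (j + 1 : ℕ)) (n - (j + 1)) *
          poch (e + 1 + (j + 1 : ℕ)) (n - (j + 1)))) =
        (-1) ^ n * (poch (c - a) n * poch (c - b) n) - poch c n * poch (e + 1) n := by
      rw [← h1, Finset.sum_range_succ]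
      simp [poch_zero]
    rw [h3, poch_succ (c - a), poch_succ (c - b)]
    simp only [pow_zero, Nat.choose_zero_right, Nat.cast_one, poch_zero, Nat.cast_zero, add_zero,
      Nat.sub_zero, add_sub_add_right_eq_sub]
    rw [poch_succ c, poch_succ_left e]
    have he : e = a + b - c - n := by push_cast at h; linarith
    linear_combination ((-1) ^ n * (poch (c - a) n * poch (c - b) n)) * (c + n) * he

/-- The Pfaff–Saalschütz sum. -/
theorem saalschutz_div (n : ℕ) (a b c e : ℝ) (h : c + e + n = a + b + 1)
    (hc : poch c n ≠ 0) (he : poch e n ≠ 0) :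
    ∑ j ∈ Finset.range (n + 1), poch (-(n : ℝ)) j * poch a j * poch b j / (poch c j * poch e j) *
      (1 / (j ! : ℝ)) = (-1) ^ n * (poch (c - a) n * poch (c - b) n) / (poch c n * poch e n) := by
  rw [← saalschutz n a b c e h, Finset.sum_div]
  refine Finset.sum_congr rfl fun j hj => ?_
  have hjn : j ≤ n := by simpa [Nat.lt_succ_iff] using hj
  obtain ⟨m, rfl⟩ := Nat.exists_eq_add_of_le hjn
  rw [poch_add] at hc he
  rw [Nat.add_sub_cancel_left, poch_add c, poch_add e, ← poch_neg_nat]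
  have := left_ne_zero_of_mul hc
  have := right_ne_zero_of_mul hc
  have := left_ne_zero_of_mul he
  have := right_ne_zero_of_mul he
  field_simp

/-! ### The three-term recursion and its square-summable solutions. -/

/-- The untruncated solution of the recursion. -/
noncomputable def wilsonEnd (n : ℕ) (μ ν : ℝ) : ℝ :=
  √((2 * n + μ + ν + 1) / (n + μ + ν + 1) *
    (poch (μ + 1) n * poch (μ + ν + 2) n / (poch (ν + 1) n * (n ! : ℝ))))

theorem wilsonEnd_pos (n : ℕ) {μ ν : ℝ} (hμ : -1 < μ) (hν : 0 ≤ ν) : 0 < wilsonEnd n μ ν := by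
  have h1 := poch_pos (show 0 < μ + 1 by linarith) n
  have h2 := poch_pos (show 0 < μ + ν + 2 by linarith) n
  have h3 := poch_pos (show 0 < ν + 1 by linarith) n
  have h4 : (0 : ℝ) ≤ n := by positivity
  have : 0 < 2 * n + μ + ν + 1 := by linarith
  have : 0 < n + μ + ν + 1 := by linarith
  unfold wilsonEnd
  positivity

theorem wilsonEnd_zero {μ ν : ℝ} (hμ : -1 < μ) (hν : 0 ≤ ν) : wilsonEnd 0 μ ν = 1 := by
  have : μ + ν + 1 ≠ 0 := by linarith
  simp [wilsonEnd, poch_zero, this]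

theorem wilsonEnd_sq_succ (n : ℕ) {μ ν : ℝ} (hμ : -1 < μ) (hν : 0 ≤ ν) :
    (2 * n + μ + ν + 1) * (n + ν + 1) * (n + 1) * wilsonEnd (n + 1) μ ν ^ 2 =
      (2 * n + μ + ν + 3) * (n + μ + ν + 1) * (n + μ + 1) * wilsonEnd n μ ν ^ 2 := by
  have h1 := poch_pos (show 0 < μ + 1 by linarith) n
  have h2 := poch_pos (show 0 < μ + ν + 2 by linarith) n
  have h3 := poch_pos (show 0 < ν + 1 by linarith) n
  have h4 : (0 : ℝ) ≤ n := by positivity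
  have h5 : 0 < 2 * n + μ + ν + 1 := by linarith
  have h6 : 0 < n + μ + ν + 1 := by linarith
  have h7 : 0 < n + μ + ν + 2 := by linarith
  have h8 : 0 < 2 * n + μ + ν + 3 := by linarith
  have h9 : 0 < n + ν + 1 := by linarith
  have h10 : 0 < n + μ + 1 := by linarith
  unfold wilsonEnd
  rw [Real.sq_sqrt, Real.sq_sqrt, poch_succ, poch_succ, poch_succ, Nat.factorial_succ]
  · push_cast
    have e1 : μ + ν + 2 + n = n + μ + ν + 2 := by ring
    have e2 : μ + 1 + (n : ℝ) = n + μ + 1 := by ring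
    have e3 : ν + 1 + (n : ℝ) = n + ν + 1 := by ring
    have e4 : (n : ℝ) + 1 + μ + ν + 1 = n + μ + ν + 2 := by ring
    have e5 : 2 * ((n : ℝ) + 1) + μ + ν + 1 = 2 * n + μ + ν + 3 := by ring
    rw [e1, e2, e3, e4, e5]
    field_simp
  · positivity
  · have := poch_pos (show 0 < μ + 1 by linarith) (n + 1)
    have := poch_pos (show 0 < μ + ν + 2 by linarith) (n + 1)
    have := poch_pos (show 0 < ν + 1 by linarith) (n + 1)
    have : 0 < 2 * ((n + 1 : ℕ) : ℝ) + μ + ν + 1 := by push_cast; linarith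
    have : 0 < ((n + 1 : ℕ) : ℝ) + μ + ν + 1 := by push_cast; linarith
    positivity

theorem coeffG_pos (n : ℕ) {μ ν : ℝ} (hμ : -1 < μ) (hν : 0 ≤ ν) : 0 < coeffG n μ ν := by
  have h4 : (0 : ℝ) ≤ n := by positivity
  have h5 : 0 < 2 * n + μ + ν + 1 := by linarith
  have h6 : 0 < n + μ + ν + 1 := by linarith
  have h7 : 0 < 2 * n + μ + ν + 2 := by linarith
  have h8 : 0 < 2 * n + μ + ν + 3 := by linarith
  have h9 : 0 < n + ν + 1 := by linarith
  have h10 : 0 < n + μ + 1 := by linarith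
  unfold coeffG
  positivity

/-- Both sides are positive, so it suffices to compare squares, where `wilsonEnd_sq_succ` gives the
ratio of consecutive terms. The square roots in the recursion disappear in this way. -/
theorem coeffG_mul_wilsonEnd_succ (n : ℕ) {μ ν : ℝ} (hμ : -1 < μ) (hν : 0 ≤ ν) :
    coeffG n μ ν * wilsonEnd (n + 1) μ ν =
      (n + μ + 1) * (n + μ + ν + 1) / ((2 * n + μ + ν + 1) * (2 * n + μ + ν + 2)) *
        wilsonEnd n μ ν := by
  have h4 : (0 : ℝ) ≤ n := by positivity
  have h5 : 0 < 2 * n + μ + ν + 1 := by linarith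
  have h6 : 0 < n + μ + ν + 1 := by linarith
  have h7 : 0 < 2 * n + μ + ν + 2 := by linarith
  have h8 : 0 < 2 * n + μ + ν + 3 := by linarith
  have h9 : 0 < n + ν + 1 := by linarith
  have h10 : 0 < n + μ + 1 := by linarith
  have hG := coeffG_pos n hμ hν
  have hE := wilsonEnd_pos n hμ hν
  have hE' := wilsonEnd_pos (n + 1) hμ hν
  have hsq := wilsonEnd_sq_succ n hμ hν
  rw [← sq_eq_sq₀ (by positivity) (by positivity), mul_pow, mul_pow]
  have hG2 : coeffG n μ ν ^ 2 = (n + 1) * (n + μ + 1) * (n + ν + 1) * (n + μ + ν + 1) /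
      ((2 * n + μ + ν + 1) * (2 * n + μ + ν + 3) * (2 * n + μ + ν + 2) ^ 2) := by
    unfold coeffG
    rw [mul_pow, Real.sq_sqrt (by positivity)]
    field_simp
  rw [hG2]
  clear hG2
  generalize (2 * n + μ + ν + 1 : ℝ) = p at *
  generalize (n + μ + ν + 1 : ℝ) = q at *
  generalize (2 * n + μ + ν + 2 : ℝ) = r at *
  generalize (2 * n + μ + ν + 3 : ℝ) = t at *
  generalize (n + ν + 1 : ℝ) = u at *
  generalize (n + μ + 1 : ℝ) = v at *
  field_simp
  linear_combination hsq

theorem coeffG_mul_wilsonEnd (n : ℕ) {μ ν : ℝ} (hμ : -1 < μ) (hν : 0 ≤ ν) :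
    coeffG n μ ν * wilsonEnd n μ ν =
      (n + 1) * (n + ν + 1) / ((2 * n + μ + ν + 2) * (2 * n + μ + ν + 3)) *
        wilsonEnd (n + 1) μ ν := by
  have h4 : (0 : ℝ) ≤ n := by positivity
  have h5 : 0 < 2 * n + μ + ν + 1 := by linarith
  have h6 : 0 < n + μ + ν + 1 := by linarith
  have h7 : 0 < 2 * n + μ + ν + 2 := by linarith
  have h8 : 0 < 2 * n + μ + ν + 3 := by linarith
  have h9 : 0 < n + ν + 1 := by linarith
  have h10 : 0 < n + μ + 1 := by linarith
  have hE := wilsonEnd_pos n hμ hν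
  have hE' := wilsonEnd_pos (n + 1) hμ hν
  have hsq := wilsonEnd_sq_succ n hμ hν
  have h := coeffG_mul_wilsonEnd_succ n hμ hν
  have h' : coeffG n μ ν = (n + μ + 1) * (n + μ + ν + 1) /
      ((2 * n + μ + ν + 1) * (2 * n + μ + ν + 2)) * wilsonEnd n μ ν / wilsonEnd (n + 1) μ ν := by
    rw [← h]; field_simp
  rw [h']
  clear h' h
  generalize (2 * n + μ + ν + 1 : ℝ) = p at *
  generalize (n + μ + ν + 1 : ℝ) = q at *
  generalize (2 * n + μ + ν + 2 : ℝ) = r at *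
  generalize (2 * n + μ + ν + 3 : ℝ) = t at *
  generalize (n + ν + 1 : ℝ) = u at *
  generalize (n + μ + 1 : ℝ) = v at *
  field_simp
  linear_combination -hsq

/-- The two summands are the rational factors of `coeffG_mul_wilsonEnd` (at `n - 1`) and
`coeffG_mul_wilsonEnd_succ`: the diagonal is built to cancel the neighbours. At `n = 0` the first
summand vanishes through its factor `n`, also when `μ + ν = 0`. -/
theorem half_one_sub_coeffF (n : ℕ) {μ ν : ℝ} (hμ : -1 < μ) (hν : 0 ≤ ν) :
    1 / 2 * (coeffF n μ ν - 1) = -(n * (n + ν) / ((2 * n + μ + ν) * (2 * n + μ + ν + 1)) +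
      (n + μ + 1) * (n + μ + ν + 1) / ((2 * n + μ + ν + 1) * (2 * n + μ + ν + 2))) := by
  unfold coeffF
  split_ifs with h
  · subst h
    have : μ + ν + 1 ≠ 0 := by linarith
    have : μ + ν + 2 ≠ 0 := by linarith
    simp
    field_simp
    ring
  · have h4 : (1 : ℝ) ≤ n := by exact_mod_cast Nat.one_le_iff_ne_zero.2 h
    have : 2 * n + μ + ν ≠ 0 := by linarith
    have : 2 * n + μ + ν + 1 ≠ 0 := by linarith
    have : 2 * n + μ + ν + 2 ≠ 0 := by linarith
    field_simp
    ring

theorem prod_sq_sub (x g : ℝ) (j : ℕ) :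
    ∏ i ∈ Finset.range j, ((x + i) ^ 2 + -(g ^ 2)) = poch (x - g) j * poch (x + g) j := by
  rw [poch_eq_prod, poch_eq_prod, ← Finset.prod_mul_distrib]
  exact Finset.prod_congr rfl fun i _ => by ring

/-- With $z^2=-\gamma^2$ the numerator parameters are $\sigma-\tau\mp\gamma$. The second of these
cancels one of the two denominator parameters $\sigma-\tau+\gamma$, and the remaining ${}_3F_2$ is
balanced. -/
theorem wilsonHyp_end (n : ℕ) {σ τ g : ℝ} (hσ : 0 < σ) (h : poch (σ - τ + g) n ≠ 0) :
    wilsonHyp n (-(g ^ 2)) (σ - τ) (σ + τ) g g =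
      poch (2 * g) n * poch (σ + τ + g) n / (poch (2 * σ) n * poch (σ - τ + g) n) := by
  have h2 : poch (2 * σ) n ≠ 0 := (poch_pos (by linarith) n).ne'
  have hs := saalschutz_div n (n + 2 * σ + 2 * g - 1) (σ - τ - g) (2 * σ) (σ - τ + g) (by ring) h2 h
  have e1 : poch (2 * σ - (n + 2 * σ + 2 * g - 1)) n = (-1) ^ n * poch (2 * g) n := by
    rw [← poch_reflect]; congr 1; ring
  rw [e1, show 2 * σ - (σ - τ - g) = σ + τ + g by ring] at hs
  have e2 : ((-1 : ℝ) ^ n * ((-1) ^ n * poch (2 * g) n * poch (σ + τ + g) n)) =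
      poch (2 * g) n * poch (σ + τ + g) n := by
    rw [← mul_assoc, ← mul_assoc, ← mul_pow]; simp
  rw [e2] at hs
  rw [← hs, wilsonHyp]
  refine Finset.sum_congr rfl fun j hj => ?_
  have hj' : poch (σ - τ + g) j ≠ 0 := by
    rw [poch_ne_zero_iff] at h ⊢
    exact fun i hi => h i (by have := Finset.mem_range.1 hj; omega)
  rw [prod_sq_sub, show σ - τ + (σ + τ) = 2 * σ by ring,
    show (n : ℝ) + (σ - τ) + (σ + τ) + g + g - 1 = n + 2 * σ + 2 * g - 1 by ring]
  congr 1
  field_simp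

/-- The factor $(\sigma-\tau+\gamma)_n$ in the normalization, taken with its sign, cancels the
denominator of the Saalschütz value, so all dependence on $\tau$ disappears. -/
theorem wilson_end (n : ℕ) {μ ν τ : ℝ} (hμ : -1 < μ) (hν : 0 ≤ ν) (hτ : 0 ≤ τ)
    (h : poch ((ν + 1) / 2 - τ + (μ + 1) / 2) n ≠ 0) :
    wilson n (-(1 / 4) * (μ + 1) ^ 2) ((ν + 1) / 2) τ ((μ + 1) / 2) = wilsonEnd n μ ν := by
  have h1 := poch_pos (show 0 < μ + 1 by linarith) n
  have h2 := poch_pos (show 0 < μ + ν + 2 by linarith) n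
  have h3 := poch_pos (show 0 < ν + 1 by linarith) n
  have h4 := poch_pos (show 0 < (ν + 1) / 2 + τ + (μ + 1) / 2 by linarith) n
  have h5 : (0 : ℝ) ≤ n := by positivity
  have h6 : 0 < 2 * n + μ + ν + 1 := by linarith
  have h7 : 0 < n + μ + ν + 1 := by linarith
  have e := wilsonHyp_end n (show 0 < (ν + 1) / 2 by linarith) h
  rw [show -(((μ + 1) / 2) ^ 2) = -(1 / 4) * (μ + 1) ^ 2 by ring] at e
  rw [wilson, e, show 2 * ((μ + 1) / 2) = μ + 1 by ring, show 2 * ((ν + 1) / 2) = ν + 1 by ring,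
    show ν + 1 + (μ + 1) = μ + ν + 2 by ring,
    show 2 * (n : ℝ) + (ν + 1) + (μ + 1) - 1 = 2 * n + μ + ν + 1 by ring,
    show (n : ℝ) + (ν + 1) + (μ + 1) - 1 = n + μ + ν + 1 by ring, wilsonEnd]
  have e2 : (2 * n + μ + ν + 1) / (n + μ + ν + 1) *
      (poch (μ + 1) n * poch (μ + ν + 2) n / (poch (ν + 1) n * (n ! : ℝ))) =
      (2 * n + μ + ν + 1) / (n + μ + ν + 1) *
      (poch (ν + 1) n * poch (μ + ν + 2) n / (poch (μ + 1) n * (n ! : ℝ))) *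
      (poch (μ + 1) n / poch (ν + 1) n) ^ 2 := by
    field_simp
  rw [e2, Real.sqrt_mul' _ (sq_nonneg (poch (μ + 1) n / poch (ν + 1) n)),
    Real.sqrt_sq (by positivity)]
  clear e e2
  generalize poch ((ν + 1) / 2 - τ + (μ + 1) / 2) n = x at *
  generalize poch ((ν + 1) / 2 + τ + (μ + 1) / 2) n = y at *
  field_simp

theorem wilson_eq_zero (n : ℕ) {t σ τ g : ℝ} (h : poch (σ - τ + g) n = 0) :
    wilson n t σ τ g = 0 := by
  simp [wilson, h]

/-- Let $q_n$ be the bracket next to $f_{n+1}$ and $L_n$ the first summand in `half_one_sub_coeffF`.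
The neighbours cancel all of the diagonal except $-L_n(q_n-q_{n-1})$, and $q_n-q_{n-1}=2n+\mu+\nu+1$
turns this into minus the remaining term $n(n+\nu)/(2n+\mu+\nu)$. -/
theorem wilsonEnd_recursion (n : ℕ) {μ ν : ℝ} (s : ℝ) (hμ : -1 < μ) (hν : 0 ≤ ν) :
    (n * (n + ν) / (2 * n + μ + ν) +
          1 / 2 * (coeffF n μ ν - 1) * ((n + (μ + ν) / 2 + 1) ^ 2 - 1 / 4 * s ^ 2)) *
            wilsonEnd n μ ν +
        (if n = 0 then 0 else
          coeffG (n - 1) μ ν * ((n + (μ + ν) / 2) ^ 2 - 1 / 4 * s ^ 2) * wilsonEnd (n - 1) μ ν) +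
        coeffG n μ ν * ((n + (μ + ν) / 2 + 1) ^ 2 - 1 / 4 * s ^ 2) * wilsonEnd (n + 1) μ ν = 0 := by
  rw [half_one_sub_coeffF n hμ hν, mul_right_comm (coeffG n μ ν), coeffG_mul_wilsonEnd_succ n hμ hν]
  rcases n with _ | n
  · simp; ring
  · have h5 : (0 : ℝ) ≤ n := by positivity
    have h6 : 2 * ((n + 1 : ℕ) : ℝ) + μ + ν ≠ 0 := by push_cast; linarith
    have h7 : 2 * ((n + 1 : ℕ) : ℝ) + μ + ν + 1 ≠ 0 := by push_cast; linarith
    rw [if_neg n.succ_ne_zero, Nat.add_sub_cancel, mul_right_comm (coeffG n μ ν),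
      coeffG_mul_wilsonEnd n hμ hν,
      show 2 * (n : ℝ) + μ + ν + 2 = 2 * ((n + 1 : ℕ) : ℝ) + μ + ν by push_cast; ring,
      show 2 * (n : ℝ) + μ + ν + 3 = 2 * ((n + 1 : ℕ) : ℝ) + μ + ν + 1 by push_cast; ring,
      show (n : ℝ) + 1 = ((n + 1 : ℕ) : ℝ) by push_cast; ring,
      show (n : ℝ) + ν + 1 = ((n + 1 : ℕ) : ℝ) + ν by push_cast; ring]
    generalize ((n + 1 : ℕ) : ℝ) = m at *
    generalize wilsonEnd (n + 1) μ ν = w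
    have h8 : m * (m + ν) / (2 * m + μ + ν) =
        m * (m + ν) / ((2 * m + μ + ν) * (2 * m + μ + ν + 1)) * (2 * m + μ + ν + 1) := by
      rw [div_mul_eq_mul_div, mul_div_mul_right _ _ h7]
    rw [h8]
    ring

/-- A sequence solves the recursion exactly if its quotient by `wilsonEnd` is locally constant
away from the zeros of the off-diagonal coefficients. -/
theorem solvesRecursion_iff {μ ν : ℝ} (s : ℝ) (hμ : -1 < μ) (hν : 0 ≤ ν) (f : ℕ → ℝ) :
    SolvesRecursion μ ν s f ↔ ∀ n : ℕ, ((n + (μ + ν) / 2 + 1) ^ 2 - 1 / 4 * s ^ 2) *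
      (f (n + 1) / wilsonEnd (n + 1) μ ν - f n / wilsonEnd n μ ν) = 0 := by
  have hE := fun n => (wilsonEnd_pos n hμ hν).ne'
  have hG := fun n => (coeffG_pos n hμ hν).ne'
  obtain ⟨χ, rfl⟩ : ∃ χ : ℕ → ℝ, f = fun n => χ n * wilsonEnd n μ ν :=
    ⟨fun n => f n / wilsonEnd n μ ν, funext fun n => by field_simp [hE n]⟩
  simp only [mul_div_cancel_right₀ _ (hE _)]
  -- Subtracting $\chi_n$ times the recursion for `wilsonEnd` leaves a difference of two fluxes. The
  -- incoming flux is absent at `n = 0`, so induction makes every flux vanish.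
  have h0 : ∀ n : ℕ, (n * (n + ν) / (2 * n + μ + ν) +
          1 / 2 * (coeffF n μ ν - 1) * ((n + (μ + ν) / 2 + 1) ^ 2 - 1 / 4 * s ^ 2)) *
            (χ n * wilsonEnd n μ ν) +
        (if n = 0 then 0 else
          coeffG (n - 1) μ ν * ((n + (μ + ν) / 2) ^ 2 - 1 / 4 * s ^ 2) *
            (χ (n - 1) * wilsonEnd (n - 1) μ ν)) +
        coeffG n μ ν * ((n + (μ + ν) / 2 + 1) ^ 2 - 1 / 4 * s ^ 2) *
          (χ (n + 1) * wilsonEnd (n + 1) μ ν) =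
      coeffG n μ ν * wilsonEnd (n + 1) μ ν *
          (((n + (μ + ν) / 2 + 1) ^ 2 - 1 / 4 * s ^ 2) * (χ (n + 1) - χ n)) -
        (if n = 0 then 0 else coeffG (n - 1) μ ν * wilsonEnd (n - 1) μ ν *
          (((n + (μ + ν) / 2) ^ 2 - 1 / 4 * s ^ 2) * (χ n - χ (n - 1)))) := by
    intro n
    have h := wilsonEnd_recursion n s hμ hν
    split_ifs at h ⊢ with hn
    · linear_combination χ n * h
    · linear_combination χ n * h
  constructor
  · intro hf n
    induction n with
    | zero =>
      have h := hf 0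
      rw [h0] at h
      simpa [hE, hG] using h
    | succ n ih =>
      have h := hf (n + 1)
      rw [h0, if_neg n.succ_ne_zero, Nat.add_sub_cancel,
        show (((n + 1 : ℕ) : ℝ) + (μ + ν) / 2) ^ 2 = (n + (μ + ν) / 2 + 1) ^ 2 by push_cast; ring,
        ih, mul_zero, sub_zero] at h
      exact (mul_eq_zero.1 h.symm).resolve_left (mul_ne_zero (hG _) (hE _))
  · intro hf n
    rw [h0, hf n]
    rcases n with _ | n
    · simp
    · rw [if_neg n.succ_ne_zero, Nat.add_sub_cancel,
        show (((n + 1 : ℕ) : ℝ) + (μ + ν) / 2) ^ 2 = (n + (μ + ν) / 2 + 1) ^ 2 by push_cast; ring,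
        hf n]
      simp

/-- The sequence $n\cdot$`wilsonEnd n ^ 2` is nondecreasing for $n\ge1$; this is where $\mu>-1$
decides against summability. -/
theorem wilsonEnd_sq_ge {μ ν : ℝ} (hμ : -1 < μ) (hν : 0 ≤ ν) (n : ℕ) :
    wilsonEnd 1 μ ν ^ 2 ≤ (n + 1) * wilsonEnd (n + 1) μ ν ^ 2 := by
  induction n with
  | zero => simp
  | succ n ih =>
    refine ih.trans ?_
    have h := wilsonEnd_sq_succ (n + 1) hμ hν
    push_cast at h ⊢
    have hm : (0 : ℝ) < (n : ℝ) + 1 := by positivity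
    generalize (n : ℝ) + 1 = m at *
    have hw := sq_nonneg (wilsonEnd (n + 1) μ ν)
    generalize wilsonEnd (n + 1) μ ν ^ 2 = w at *
    have h1 : 0 < 2 * m + μ + ν + 1 := by linarith
    have h2 : 0 < m + ν + 1 := by linarith
    have hp : 0 < μ + 1 := by linarith
    -- The difference is expanded in powers of `m` so that each coefficient is visibly nonnegative
    -- in terms of $\mu+1>0$ and $\nu\ge0$.
    have key : m * (2 * m + μ + ν + 1) * (m + ν + 1) ≤
        (2 * m + μ + ν + 3) * (m + μ + ν + 1) * (m + μ + 1) := by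
      have : (2 * m + μ + ν + 3) * (m + μ + ν + 1) * (m + μ + 1) -
          m * (2 * m + μ + ν + 1) * (m + ν + 1) = 4 * (μ + 1) * m ^ 2 +
          (2 * ((μ + 1 + ν) * (μ + 1)) + (μ + 1 + ν) * (μ + 1 + 1) +
            (μ + 1 + ν + 2) * (μ + 1)) * m + (μ + 1 + ν + 2) * (μ + 1 + ν) * (μ + 1) := by ring
      have h3 : 0 ≤ 4 * (μ + 1) * m ^ 2 +
          (2 * ((μ + 1 + ν) * (μ + 1)) + (μ + 1 + ν) * (μ + 1 + 1) +
            (μ + 1 + ν + 2) * (μ + 1)) * m + (μ + 1 + ν + 2) * (μ + 1 + ν) * (μ + 1) := by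
        positivity
      linarith
    refine le_of_mul_le_mul_left ?_ (mul_pos h1 h2)
    calc (2 * m + μ + ν + 1) * (m + ν + 1) * (m * w)
        = m * (2 * m + μ + ν + 1) * (m + ν + 1) * w := by ring
      _ ≤ (2 * m + μ + ν + 3) * (m + μ + ν + 1) * (m + μ + 1) * w :=
          mul_le_mul_of_nonneg_right key hw
      _ = _ := by rw [← h]; ring

/-- A nonzero multiple would have squares that dominate a multiple of the harmonic series. -/
theorem eq_zero_of_summable {μ ν : ℝ} (hμ : -1 < μ) (hν : 0 ≤ ν) {f : ℕ → ℝ} {p : ℝ} {m : ℕ}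
    (hf : ∀ n, m ≤ n → f n = p * wilsonEnd n μ ν) (hs : Summable fun n => f n ^ 2) : p = 0 := by
  by_contra hp
  have h1 : Summable fun n : ℕ => f (n + m + 1) ^ 2 := by
    simpa [add_assoc] using (summable_nat_add_iff (m + 1)).2 hs
  have h0 := wilsonEnd_pos 1 hμ hν
  have h2 : Summable fun n : ℕ => p ^ 2 * wilsonEnd 1 μ ν ^ 2 * (1 / ((n + (m + 1) : ℕ) : ℝ)) := by
    refine Summable.of_nonneg_of_le (fun n => by positivity) (fun n => ?_) h1
    have h3 := wilsonEnd_sq_ge hμ hν (n + m)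
    rw [hf _ (by omega), mul_pow, mul_assoc]
    refine mul_le_mul_of_nonneg_left ?_ (sq_nonneg p)
    rw [mul_one_div, div_le_iff₀ (by positivity)]
    refine h3.trans (le_of_eq ?_)
    push_cast
    ring
  have hc : p ^ 2 * wilsonEnd 1 μ ν ^ 2 ≠ 0 := by positivity
  rw [summable_mul_left_iff hc] at h2
  exact Real.not_summable_one_div_natCast ((summable_nat_add_iff (m + 1)).1 h2)

theorem offdiag_factor (n : ℕ) (μ ν s : ℝ) : (n + (μ + ν) / 2 + 1) ^ 2 - 1 / 4 * s ^ 2 =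
    ((ν + 1) / 2 - |s| / 2 + (μ + 1) / 2 + n) *
      ((ν + 1) / 2 + |s| / 2 + (μ + 1) / 2 + n) := by
  rw [← sq_abs s]; ring

theorem offdiag_eq_zero_iff (n : ℕ) {μ ν : ℝ} (s : ℝ) (hμ : -1 < μ) (hν : 0 ≤ ν) :
    (n + (μ + ν) / 2 + 1) ^ 2 - 1 / 4 * s ^ 2 = 0 ↔
      (ν + 1) / 2 - |s| / 2 + (μ + 1) / 2 + n = 0 := by
  have : (ν + 1) / 2 + |s| / 2 + (μ + 1) / 2 + n ≠ 0 := by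
    have := abs_nonneg s
    have : (0 : ℝ) ≤ n := by positivity
    apply ne_of_gt; linarith
  rw [offdiag_factor, mul_eq_zero, or_iff_left this]

/-- The quotient by `wilsonEnd` is one before the first zero of $(\sigma-\tau+\gamma)_n$ and zero
from there on. Its only jump sits where the off-diagonal coefficient vanishes. -/
theorem wilson_solvesRecursion {μ ν : ℝ} (s : ℝ) (hμ : -1 < μ) (hν : 0 ≤ ν) :
    SolvesRecursion μ ν s
      (fun n => wilson n (-(1 / 4) * (μ + 1) ^ 2) ((ν + 1) / 2) (|s| / 2) ((μ + 1) / 2)) := by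
  rw [solvesRecursion_iff s hμ hν]
  intro n
  have hE := fun n => (wilsonEnd_pos n hμ hν).ne'
  have hτ : 0 ≤ |s| / 2 := by positivity
  by_cases h : poch ((ν + 1) / 2 - |s| / 2 + (μ + 1) / 2) (n + 1) = 0
  · by_cases h' : poch ((ν + 1) / 2 - |s| / 2 + (μ + 1) / 2) n = 0
    · simp [wilson_eq_zero _ h, wilson_eq_zero _ h']
    · rw [poch_succ] at h
      rw [(offdiag_eq_zero_iff n s hμ hν).2 ((mul_eq_zero.1 h).resolve_left h'), zero_mul]
  · have h' : poch ((ν + 1) / 2 - |s| / 2 + (μ + 1) / 2) n ≠ 0 := by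
      rw [poch_succ] at h; exact left_ne_zero_of_mul h
    rw [wilson_end _ hμ hν hτ h, wilson_end _ hμ hν hτ h', div_self (hE _), div_self (hE _)]
    simp

theorem quotient_const {μ ν s : ℝ} (hμ : -1 < μ) (hν : 0 ≤ ν) {f : ℕ → ℝ}
    (hf : SolvesRecursion μ ν s f) {l m : ℕ} (hlm : l ≤ m)
    (h : ∀ n, l ≤ n → n < m → (ν + 1) / 2 - |s| / 2 + (μ + 1) / 2 + n ≠ 0) :
    f m = f l / wilsonEnd l μ ν * wilsonEnd m μ ν := by
  rw [solvesRecursion_iff s hμ hν] at hf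
  have hE := fun n => (wilsonEnd_pos n hμ hν).ne'
  induction m, hlm using Nat.le_induction with
  | base => field_simp [hE l]
  | succ m hm ih =>
    have h1 := ih fun n h1 h2 => h n h1 (by omega)
    have h2 := hf m
    have h3 := (offdiag_eq_zero_iff m s hμ hν).not.2 (h m hm (by omega))
    have h4 := sub_eq_zero.1 ((mul_eq_zero.1 h2).resolve_left h3)
    rw [h1, mul_div_cancel_right₀ _ (hE m)] at h4
    rw [← h4, div_mul_cancel₀ _ (hE _)]

/-- Every square-summable solution is a multiple of the Wilson polynomials. -/
theorem eq_mul_wilson_of_summable {μ ν s : ℝ} (hμ : -1 < μ) (hν : 0 ≤ ν) {f : ℕ → ℝ}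
    (hf : SolvesRecursion μ ν s f) (hs : Summable fun n => f n ^ 2) (n : ℕ) :
    f n = f 0 * wilson n (-(1 / 4) * (μ + 1) ^ 2) ((ν + 1) / 2) (|s| / 2) ((μ + 1) / 2) := by
  have hτ : 0 ≤ |s| / 2 := by positivity
  by_cases hk : ∃ k : ℕ, (ν + 1) / 2 - |s| / 2 + (μ + 1) / 2 + k = 0
  · obtain ⟨k, hk⟩ := hk
    have hne : ∀ i : ℕ, i ≠ k → (ν + 1) / 2 - |s| / 2 + (μ + 1) / 2 + i ≠ 0 := by
      intro i hi h
      exact hi (by exact_mod_cast (show (i : ℝ) = k by linarith))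
    rcases le_or_gt n k with hn | hn
    · have h1 := quotient_const hμ hν hf n.zero_le fun i _ hi => hne i (by omega)
      rw [wilson_end n hμ hν hτ ((poch_ne_zero_iff _ _).2 fun i hi => hne i (by omega)), h1,
        wilsonEnd_zero hμ hν, div_one]
    · rw [wilson_eq_zero n ((poch_eq_zero_iff _ _).2 ⟨k, hn, hk⟩), mul_zero]
      -- The broken link separates the indices above `k` from the rest: there the solution is its
      -- own multiple of `wilsonEnd`, which summability forces to be zero.
      have h1 := fun m (hm : k + 1 ≤ m) =>
        quotient_const hμ hν hf hm fun i hi _ => hne i (by omega)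
      rw [h1 n hn, eq_zero_of_summable hμ hν h1 hs, zero_mul]
  · push Not at hk
    have h1 := fun m => quotient_const hμ hν hf (Nat.zero_le m) fun i _ _ => hk i
    have h2 := eq_zero_of_summable hμ hν (m := 0) (fun m _ => h1 m) hs
    rw [wilson_end n hμ hν hτ ((poch_ne_zero_iff _ _).2 fun i _ => hk i), h1 n]
    rw [wilsonEnd_zero hμ hν, div_one] at *

/-- A nonzero square-summable solution exists exactly if the parameter `σ - τ + γ` is a
nonpositive integer. -/
theorem exists_summable_iff {μ ν : ℝ} (s : ℝ) (hμ : -1 < μ) (hν : 0 ≤ ν) :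
    (∃ f : ℕ → ℝ, f ≠ 0 ∧ Summable (fun n => f n ^ 2) ∧ SolvesRecursion μ ν s f) ↔
      ∃ k : ℕ, (ν + 1) / 2 - |s| / 2 + (μ + 1) / 2 + k = 0 := by
  have hτ : 0 ≤ |s| / 2 := by positivity
  constructor
  · rintro ⟨f, hf0, hs, hf⟩
    by_contra hk
    push Not at hk
    have h1 := fun m => quotient_const hμ hν hf (Nat.zero_le m) fun i _ _ => hk i
    have h2 := eq_zero_of_summable hμ hν (m := 0) (fun m _ => h1 m) hs
    refine hf0 (funext fun n => ?_)
    rw [h1 n, h2, zero_mul, Pi.zero_apply]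
  · rintro ⟨k, hk⟩
    refine ⟨_, fun h => ?_, ?_, wilson_solvesRecursion s hμ hν⟩
    · have h0 := congrFun h 0
      simp only [Pi.zero_apply] at h0
      rw [wilson_end 0 hμ hν hτ (by simp [poch_zero]), wilsonEnd_zero hμ hν] at h0
      exact one_ne_zero h0
    · have h0 : ∀ n : ℕ, n ∉ Finset.range (k + 1) → wilson n (-(1 / 4) * (μ + 1) ^ 2) ((ν + 1) / 2)
          (|s| / 2) ((μ + 1) / 2) ^ 2 = 0 := by
        intro n hn
        have hn' : k < n := by have := Finset.mem_range.not.1 hn; omega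
        rw [wilson_eq_zero n ((poch_eq_zero_iff _ _).2 ⟨k, hn', hk⟩)]
        simp
      exact summable_of_ne_finset_zero h0

/-! ### Moments of the discrete weight and orthogonality of the Wilson polynomials. -/

/-- All `n` factors are negative, the largest being `x + n - 1`; reversing their order makes them
positive. -/
theorem neg_one_pow_mul_poch_pos {x : ℝ} {n : ℕ} (h : x + n < 1) : 0 < (-1) ^ n * poch x n := by
  have h1 := poch_reflect (1 - x - n) n
  rw [show 1 - (1 - x - n) - n = x by ring] at h1
  rw [h1, ← mul_assoc, ← mul_pow]
  simpa using poch_pos (by linarith) n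

theorem poch_ne_zero_of_lt {x : ℝ} {n : ℕ} (h : x + n < 1) : poch x n ≠ 0 :=
  right_ne_zero_of_mul (neg_one_pow_mul_poch_pos h).ne'

theorem poch_neg_nat_ne_zero {k n : ℕ} (h : n ≤ k) : poch (-(k : ℝ)) n ≠ 0 := by
  apply poch_ne_zero_of_lt
  have : (n : ℝ) ≤ k := by exact_mod_cast h
  linarith

theorem poch_neg_self (n : ℕ) : poch (-(n : ℝ)) n = (-1) ^ n * (n ! : ℝ) := by
  have h := poch_neg_nat n n
  have : (n ! : ℝ) ≠ 0 := by positivity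
  rw [Nat.choose_self, Nat.cast_one, mul_one] at h
  rw [← h]; field_simp

/-- The part of the discrete weight that depends on the node. -/
noncomputable def racahWeight (j : ℕ) (σ τ g : ℝ) : ℝ :=
  (j + σ - τ) * (poch (2 * σ - 2 * τ) j * poch (2 * σ) j * poch (σ - τ + g) j ^ 2 /
    (poch (1 - 2 * τ) j * poch (σ - τ - g + 1) j ^ 2 * (j ! : ℝ)))

/-- The product `∏ (c + l)² + z_j²`, where `x = a + j` and `z_j² = -x²`. -/
noncomputable def nodeProd (c x : ℝ) (i : ℕ) : ℝ := poch (c - x) i * poch (c + x) i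

theorem nodeProd_succ (c x : ℝ) (i : ℕ) :
    nodeProd c x (i + 1) = nodeProd c x i * ((c + i) ^ 2 - x ^ 2) := by
  rw [nodeProd, nodeProd, poch_succ, poch_succ]; ring

/-- Moving to the next node only changes the end factors of the two Pochhammer symbols. The form
without division also covers nodes where factors vanish. -/
theorem nodeProd_shift (c x : ℝ) (i : ℕ) :
    nodeProd c (x + 1) i * ((c + x) * (x + 1 - c - i)) =
      nodeProd c x i * ((x + c + i) * (x + 1 - c)) := by
  have h1 := (poch_succ (c - (x + 1)) i).symm.trans (poch_succ_left _ i)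
  have h2 := (poch_succ_left (c + x) i).symm.trans (poch_succ _ i)
  rw [show c - (x + 1) + 1 = c - x by ring] at h1
  rw [show c + x + 1 = c + (x + 1) by ring] at h2
  unfold nodeProd
  linear_combination (-(c + x) * poch (c + (x + 1)) i) * h1 -
    ((c - (x + 1)) * poch (c - x) i) * h2

theorem nodeProd_eq_prod (c x : ℝ) (i : ℕ) :
    nodeProd c x i = ∏ l ∈ Finset.range i, ((c + l) ^ 2 + -(x ^ 2)) := (prod_sq_sub c x i).symm

section Racah

variable {σ τ g : ℝ} {k : ℕ}

theorem racahWeight_succ (hg : 0 < g) (hσ : 0 < σ) (h : σ - τ + g = -k) {j : ℕ} (hj : j < k) :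
    racahWeight (j + 1) σ τ g * ((σ - τ + j) * (j + 1) * (1 - 2 * τ + j) * (σ - τ - g + 1 + j) ^ 2) =
      racahWeight j σ τ g * ((σ - τ + j + 1) * (2 * σ - 2 * τ + j) * (2 * σ + j) *
        (σ - τ + g + j) ^ 2) := by
  have hjk : (j : ℝ) + 1 ≤ k := by exact_mod_cast hj
  have hj0 : (0 : ℝ) ≤ j := by positivity
  have h1 : poch (1 - 2 * τ) (j + 1) ≠ 0 := poch_ne_zero_of_lt (by push_cast; linarith)
  have h2 : poch (σ - τ - g + 1) (j + 1) ≠ 0 := poch_ne_zero_of_lt (by push_cast; linarith)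
  rw [poch_succ] at h1 h2
  have h3 := left_ne_zero_of_mul h1
  have h4 := right_ne_zero_of_mul h1
  have h5 := left_ne_zero_of_mul h2
  have h6 := right_ne_zero_of_mul h2
  have h7 : (j ! : ℝ) ≠ 0 := by positivity
  have h8 : (j : ℝ) + 1 ≠ 0 := by positivity
  unfold racahWeight
  simp only [poch_succ, Nat.factorial_succ]
  push_cast
  generalize poch (1 - 2 * τ) j = p1 at *
  generalize poch (σ - τ - g + 1) j = p2 at *
  generalize poch (2 * σ - 2 * τ) j = p3 at *
  generalize poch (2 * σ) j = p4 at *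
  generalize poch (σ - τ + g) j = p5 at *
  generalize 1 - 2 * τ + (j : ℝ) = q1 at *
  generalize σ - τ - g + 1 + (j : ℝ) = q2 at *
  field_simp
  ring

/-- The weighted summand with shifted parameters. -/
noncomputable def racahTerm (σ τ g : ℝ) (i m j : ℕ) : ℝ :=
  racahWeight j σ τ g * (nodeProd (σ - τ) (σ - τ + j) i * nodeProd (σ + τ) (σ - τ + j) m)

theorem racahTerm_succ (hg : 0 < g) (hσ : 0 < σ) (h : σ - τ + g = -k) (i m : ℕ) {j : ℕ}
    (hj : j < k) :
    racahTerm σ τ g i m (j + 1) * ((σ - τ + j) * (j + 1 - i) * (1 - 2 * τ + j - m) *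
        (σ - τ - g + 1 + j) ^ 2) =
      racahTerm σ τ g i m j * ((σ - τ + j + 1) * (2 * σ - 2 * τ + j + i) * (2 * σ + j + m) *
        (σ - τ + g + j) ^ 2) := by
  have hjk : (j : ℝ) + 1 ≤ k := by exact_mod_cast hj
  have hj0 : (0 : ℝ) ≤ j := by positivity
  have h1 := racahWeight_succ hg hσ h hj
  have h2 := nodeProd_shift (σ - τ) (σ - τ + j) i
  have h3 := nodeProd_shift (σ + τ) (σ - τ + j) m
  have n1 : 2 * σ - 2 * τ + j ≠ 0 := by apply ne_of_lt; linarith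
  have n2 : (j : ℝ) + 1 ≠ 0 := by positivity
  have n3 : 2 * σ + j ≠ 0 := by positivity
  have n4 : 1 - 2 * τ + j ≠ 0 := by apply ne_of_lt; linarith
  have h4 := congrArg₂ (· * ·) h1 (congrArg₂ (· * ·) h2 h3)
  unfold racahTerm
  rw [show σ - τ + ((j + 1 : ℕ) : ℝ) = σ - τ + j + 1 by push_cast; ring]
  -- The product of the weight relation and the two shift relations carries these extra factors,
  -- nonzero since $\sigma-\tau=-k-\gamma$ and $j<k$.
  refine mul_right_cancel₀ (mul_ne_zero (mul_ne_zero n1 n2) (mul_ne_zero n3 n4)) ?_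
  linear_combination h4

/-- The moments of the discrete weight. -/
noncomputable def racahSum (σ τ g : ℝ) (k i m : ℕ) : ℝ :=
  ∑ j ∈ Finset.range (k + 1), racahTerm σ τ g i m j

/-- Put $x=\sigma-\tau+j$ and $F(x)=(x+\sigma-\tau+i)(x+\sigma+\tau+m)(x+\gamma)^2$. The even
polynomial in the sum is $(F(x)-F(-x))/(2x)$, and by `racahTerm_succ` the term with $F(x)/x$ at $j$
equals the term with $F(-x)/x$ at $j+1$. The upper boundary term vanishes because $x=-\gamma$ at
$j=k$. -/
theorem racahSum_telescope (hg : 0 < g) (hσ : 0 < σ) (h : σ - τ + g = -k) (i m : ℕ) :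
    ∑ j ∈ Finset.range (k + 1), racahTerm σ τ g i m j *
      ((2 * σ + 2 * g + i + m) * (σ - τ + j) ^ 2 + (2 * (σ - τ + i) * (σ + τ + m) * g +
        (2 * σ + i + m) * g ^ 2)) = 0 := by
  set R : ℕ → ℝ := fun j => racahTerm σ τ g i m j * ((j - i) * (j - 2 * τ - m) *
    (σ - τ + j - g) ^ 2) / (σ - τ + j) with hR
  have hx : ∀ j ∈ Finset.range (k + 1), σ - τ + j ≠ 0 := by
    intro j hj
    have : (j : ℝ) ≤ k := by exact_mod_cast Nat.lt_succ_iff.1 (Finset.mem_range.1 hj)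
    apply ne_of_lt; linarith
  have h1 : ∀ j ∈ Finset.range (k + 1), racahTerm σ τ g i m j *
      ((2 * σ + 2 * g + i + m) * (σ - τ + j) ^ 2 + (2 * (σ - τ + i) * (σ + τ + m) * g +
        (2 * σ + i + m) * g ^ 2)) = 1 / 2 * (racahTerm σ τ g i m j *
          ((2 * σ - 2 * τ + j + i) * (2 * σ + j + m) * (σ - τ + g + j) ^ 2) / (σ - τ + j) - R j) := by
    intro j hj
    have := hx j hj
    simp only [hR]
    field_simp
    ring
  have h2 : ∀ j ∈ Finset.range k, racahTerm σ τ g i m j *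
      ((2 * σ - 2 * τ + j + i) * (2 * σ + j + m) * (σ - τ + g + j) ^ 2) / (σ - τ + j) =
        R (j + 1) := by
    intro j hj
    have hj' := Finset.mem_range.1 hj
    have e1 := hx j (Finset.mem_range.2 (by omega))
    have e2 := hx (j + 1) (Finset.mem_range.2 (by omega))
    have e3 := racahTerm_succ hg hσ h i m hj'
    simp only [hR]
    rw [div_eq_div_iff e1 e2]
    push_cast at e2 ⊢
    linear_combination -e3
  rw [Finset.sum_congr rfl h1, ← Finset.mul_sum, Finset.sum_sub_distrib, Finset.sum_range_succ,
    Finset.sum_congr rfl h2, Finset.sum_range_succ' R, h]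
  -- For `i = 0` the factor `j - i` vanishes at `j = 0`; for `i > 0` the node product already does.
  have h3 : R 0 = 0 := by
    simp only [hR]
    rcases i with _ | i
    · simp
    · simp [racahTerm, nodeProd, poch_succ_left]
  rw [h3]
  simp

/-- Raising `i` inserts $(\sigma-\tau+i)^2-x^2$ in each term, so the telescoped identity, linear in
$x^2$, expresses the new moment by the old one. -/
theorem racahSum_succ_left (hg : 0 < g) (hσ : 0 < σ) (h : σ - τ + g = -k) (i m : ℕ) :
    racahSum σ τ g k (i + 1) m * (2 * σ + 2 * g + (i + m : ℕ)) =
      racahSum σ τ g k i m * ((2 * σ + (i + m : ℕ)) * (σ - τ + g + i) ^ 2) := by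
  have h1 := racahSum_telescope hg hσ h i m
  rw [racahSum, racahSum, Finset.sum_mul, Finset.sum_mul, ← sub_eq_zero, ← Finset.sum_sub_distrib,
    ← neg_eq_zero, ← h1, ← Finset.sum_neg_distrib]
  refine Finset.sum_congr rfl fun j _ => ?_
  rw [racahTerm, racahTerm, nodeProd_succ]
  push_cast
  ring

theorem racahSum_succ_right (hg : 0 < g) (hσ : 0 < σ) (h : σ - τ + g = -k) (i m : ℕ) :
    racahSum σ τ g k i (m + 1) * (2 * σ + 2 * g + (i + m : ℕ)) =
      racahSum σ τ g k i m * ((2 * σ + (i + m : ℕ)) * (σ + τ + g + m) ^ 2) := by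
  have h1 := racahSum_telescope hg hσ h i m
  rw [racahSum, racahSum, Finset.sum_mul, Finset.sum_mul, ← sub_eq_zero, ← Finset.sum_sub_distrib,
    ← neg_eq_zero, ← h1, ← Finset.sum_neg_distrib]
  refine Finset.sum_congr rfl fun j _ => ?_
  rw [racahTerm, racahTerm, nodeProd_succ]
  push_cast
  ring

/-- The two first-order recursions are solved by a product formula, which leaves only the total mass
unknown. -/
theorem racahSum_eq (hg : 0 < g) (hσ : 0 < σ) (h : σ - τ + g = -k) (i m : ℕ) :
    racahSum σ τ g k i m * poch (2 * σ + 2 * g) (i + m) =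
      racahSum σ τ g k 0 0 * (poch (2 * σ) (i + m) * poch (σ - τ + g) i ^ 2 *
        poch (σ + τ + g) m ^ 2) := by
  induction i with
  | zero =>
    induction m with
    | zero => simp [poch_zero]
    | succ m ih =>
      have h1 := racahSum_succ_right hg hσ h 0 m
      rw [← add_assoc, poch_succ, poch_succ, poch_succ (σ + τ + g)]
      linear_combination poch (2 * σ + 2 * g) (0 + m) * h1 +
        ((2 * σ + (0 + m : ℕ)) * (σ + τ + g + m) ^ 2) * ih
  | succ i ih =>
    have h1 := racahSum_succ_left hg hσ h i m
    rw [show i + 1 + m = i + m + 1 by ring, poch_succ, poch_succ, poch_succ (σ - τ + g)]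
    linear_combination poch (2 * σ + 2 * g) (i + m) * h1 +
      ((2 * σ + (i + m : ℕ)) * (σ - τ + g + i) ^ 2) * ih

/-- The total mass of the discrete weight. -/
theorem racahSum_zero (hg : 0 < g) (hσ : 0 < σ) (h : σ - τ + g = -k) :
    racahSum σ τ g k 0 0 * (poch (2 * σ + 2 * g + k) k * poch (2 * g) k ^ 2) =
      -g * (poch (2 * g + 1) (2 * k) * poch (2 * σ + 2 * g) k) := by
  have h1 := racahSum_eq hg hσ h k 0
  -- The product with `i = k` contains $(-j)_k$ and kills every node with $j<k$. Comparing the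
  -- single surviving term with `racahSum_eq` yields the total mass.
  have h2 : racahSum σ τ g k k 0 = racahTerm σ τ g k 0 k := by
    rw [racahSum, Finset.sum_range_succ, Finset.sum_eq_zero, zero_add]
    intro j hj
    rw [racahTerm, nodeProd, show σ - τ - (σ - τ + j) = -(j : ℝ) by ring,
      poch_neg_nat_eq_zero (Finset.mem_range.1 hj)]
    simp
  have e1 : poch (2 * σ - 2 * τ) k * poch (2 * σ - 2 * τ + k) k = poch (2 * g + 1) (2 * k) := by
    rw [← poch_add, ← two_mul]
    have := poch_reflect (2 * g + 1) (2 * k)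
    rw [pow_mul, neg_one_sq, one_pow, one_mul] at this
    rw [← this]
    congr 1
    push_cast
    linarith
  have e2 : poch (1 - 2 * τ) k = (-1) ^ k * poch (2 * σ + 2 * g + k) k := by
    rw [← poch_reflect]; congr 1; linarith
  have e3 : poch (σ - τ - g + 1) k = (-1) ^ k * poch (2 * g) k := by
    rw [← poch_reflect]; congr 1; linarith
  have hs : ((-1 : ℝ) ^ k) ^ 2 = 1 := by rw [← pow_mul, mul_comm, pow_mul]; simp
  have p1 := poch_pos (show 0 < 2 * σ + 2 * g + k by positivity) k
  have p2 := poch_pos (show 0 < 2 * g by positivity) k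
  have p3 := poch_pos (show 0 < 2 * σ by positivity) k
  have hf : (0 : ℝ) < (k ! : ℝ) := by positivity
  have hm : ((-1 : ℝ) ^ k) ≠ 0 := by simp
  rw [h2, racahTerm, racahWeight, nodeProd, nodeProd, show σ - τ - (σ - τ + k) = -(k : ℝ) by ring,
    show σ - τ + (σ - τ + k) = 2 * σ - 2 * τ + k by ring, h, poch_neg_self, e2, e3, poch_zero,
    poch_zero, poch_zero, show (k : ℝ) + σ - τ = -g by linarith, add_zero] at h1
  rw [← e1]
  generalize ((-1 : ℝ) ^ k) = ε at *
  generalize poch (2 * σ + 2 * g + k) k = x1 at *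
  generalize poch (2 * g) k = x2 at *
  generalize poch (2 * σ) k = x3 at *
  generalize (k ! : ℝ) = x4 at *
  generalize poch (2 * σ - 2 * τ) k = x5 at *
  generalize poch (2 * σ - 2 * τ + k) k = x6 at *
  generalize poch (2 * σ + 2 * g) k = x7 at *
  generalize racahSum σ τ g k 0 0 = x8 at *
  have h4 : x8 * (x3 * (ε * x4) ^ 2) * (x1 * x2 ^ 2) =
      -g * (x5 * x6 * x7) * (x3 * (ε * x4) ^ 2) := by
    rw [show x8 * (x3 * (ε * x4) ^ 2) = x8 * (x3 * (ε * x4) ^ 2 * 1 ^ 2) by ring, ← h1]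
    field_simp
    linear_combination x5 * x6 * x7 * hs
  refine mul_right_cancel₀ (show x3 * (ε * x4) ^ 2 ≠ 0 by positivity) ?_
  linear_combination h4

/-- The coefficients of the Wilson polynomial. -/
noncomputable def wilsonCoeff (σ τ g : ℝ) (n i : ℕ) : ℝ :=
  poch (-(n : ℝ)) i * poch (n + 2 * σ + 2 * g - 1) i /
    (poch (2 * σ) i * poch (σ - τ + g) i ^ 2) * (1 / (i ! : ℝ))

theorem wilsonHyp_node (σ τ g : ℝ) (n j : ℕ) :
    wilsonHyp n (zSq j σ τ) (σ - τ) (σ + τ) g g =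
      ∑ i ∈ Finset.range (n + 1), wilsonCoeff σ τ g n i * nodeProd (σ - τ) (σ - τ + j) i := by
  refine Finset.sum_congr rfl fun i _ => ?_
  rw [nodeProd_eq_prod, wilsonCoeff, zSq, show (j : ℝ) + σ - τ = σ - τ + j by ring,
    show σ - τ + (σ + τ) = 2 * σ by ring,
    show (n : ℝ) + (σ - τ) + (σ + τ) + g + g - 1 = n + 2 * σ + 2 * g - 1 by ring]
  ring

/-- In the product formula for the moments, $(\sigma-\tau+\gamma)_i^2$ cancels the denominators of
the Wilson coefficients; these are nonzero because $i\le n\le k$. A balanced ${}_3F_2$ remains, and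
its Saalschütz value contains $(-m)_n$, which is zero for $m<n$. -/
theorem wilson_moment (hg : 0 < g) (hσ : 0 < σ) (h : σ - τ + g = -k) {n : ℕ} (hn : n ≤ k) (m : ℕ) :
    ∑ j ∈ Finset.range (k + 1), racahWeight j σ τ g *
      (wilsonHyp n (zSq j σ τ) (σ - τ) (σ + τ) g g * nodeProd (σ + τ) (σ - τ + j) m) =
    racahSum σ τ g k 0 0 * (poch (σ + τ + g) m ^ 2 * (poch (2 * σ) m / poch (2 * σ + 2 * g) m) *
      (poch (2 * g) n * poch (-(m : ℝ)) n / (poch (2 * σ) n * poch (2 * σ + 2 * g + m) n))) := by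
  have p1 := fun n => (poch_pos (show 0 < 2 * σ by positivity) n).ne'
  have p2 := fun n => (poch_pos (show 0 < 2 * σ + 2 * g by positivity) n).ne'
  have p3 := fun n => (poch_pos (show 0 < 2 * σ + 2 * g + m by positivity) n).ne'
  have hs := saalschutz_div n (n + 2 * σ + 2 * g - 1) (2 * σ + m) (2 * σ) (2 * σ + 2 * g + m)
    (by ring) (p1 n) (p3 n)
  have e1 : poch (2 * σ - (n + 2 * σ + 2 * g - 1)) n = (-1) ^ n * poch (2 * g) n := by
    rw [← poch_reflect]; congr 1; ring
  have hsgn : (-1 : ℝ) ^ n * (-1) ^ n = 1 := by rw [← mul_pow]; simp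
  rw [e1, show 2 * σ - (2 * σ + m) = -(m : ℝ) by ring, ← mul_assoc, ← mul_assoc, hsgn, one_mul] at hs
  rw [← hs]
  have h1 : ∀ j ∈ Finset.range (k + 1), racahWeight j σ τ g *
      (wilsonHyp n (zSq j σ τ) (σ - τ) (σ + τ) g g * nodeProd (σ + τ) (σ - τ + j) m) =
      ∑ i ∈ Finset.range (n + 1), wilsonCoeff σ τ g n i * racahTerm σ τ g i m j := by
    intro j _
    rw [wilsonHyp_node, Finset.sum_mul, Finset.mul_sum]
    refine Finset.sum_congr rfl fun i _ => ?_
    rw [racahTerm]; ring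
  rw [Finset.sum_congr rfl h1, Finset.sum_comm, Finset.mul_sum, Finset.mul_sum]
  refine Finset.sum_congr rfl fun i hi => ?_
  rw [← Finset.mul_sum, ← racahSum]
  have hi' : i ≤ k := (Nat.lt_succ_iff.1 (Finset.mem_range.1 hi)).trans hn
  have h2 := racahSum_eq hg hσ h i m
  have h3 : poch (σ - τ + g) i ≠ 0 := by rw [h]; exact poch_neg_nat_ne_zero hi'
  have h4 : racahSum σ τ g k i m = racahSum σ τ g k 0 0 * (poch (2 * σ) (i + m) *
      poch (σ - τ + g) i ^ 2 * poch (σ + τ + g) m ^ 2) / poch (2 * σ + 2 * g) (i + m) := by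
    rw [← h2, mul_div_cancel_right₀ _ (p2 _)]
  have p4 := p1 i
  have p5 := p2 m
  have p6 := p3 i
  rw [h4, wilsonCoeff, add_comm i m, poch_add, poch_add]
  generalize poch (2 * σ) i = x1 at *
  generalize poch (2 * σ + 2 * g) m = x2 at *
  generalize poch (2 * σ + 2 * g + m) i = x3 at *
  generalize poch (σ - τ + g) i = x4 at *
  have hf : (i ! : ℝ) ≠ 0 := by positivity
  field_simp

/-- Orthogonality to all products of degree at most `n`. -/
theorem wilson_moment_mixed (hg : 0 < g) (hσ : 0 < σ) (h : σ - τ + g = -k) {n : ℕ} (hn : n ≤ k)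
    (i : ℕ) : ∀ m, i + m ≤ n → ∑ j ∈ Finset.range (k + 1), racahWeight j σ τ g *
      (wilsonHyp n (zSq j σ τ) (σ - τ) (σ + τ) g g *
        (nodeProd (σ - τ) (σ - τ + j) i * nodeProd (σ + τ) (σ - τ + j) m)) =
    if i + m = n then racahSum σ τ g k 0 0 * (poch (σ + τ + g) n ^ 2 *
      (poch (2 * σ) n / poch (2 * σ + 2 * g) n) * (poch (2 * g) n * poch (-(n : ℝ)) n /
        (poch (2 * σ) n * poch (2 * σ + 2 * g + n) n))) else 0 := by
  induction i with
  | zero =>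
    intro m hm
    have h1 := wilson_moment hg hσ h hn m
    have h2 : ∀ x, nodeProd (σ - τ) x 0 = 1 := fun x => by simp [nodeProd, poch_zero]
    simp only [h2, one_mul]
    rw [h1]
    split_ifs with hmn
    · rw [← hmn, zero_add]
    · rw [poch_neg_nat_eq_zero (show m < n by omega)]; simp
  | succ i ih =>
    intro m hm
    have h1 := ih (m + 1) (by omega)
    have h2 := ih m (by omega)
    rw [if_neg (by omega)] at h2
    -- The next factors $(\sigma-\tau+i)^2-x^2$ and $(\sigma+\tau+m)^2-x^2$ differ by a constant, so
    -- exchanging one for the other costs a multiple of `h2`, which is zero in lower degree.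
    rw [show i + 1 + m = i + (m + 1) by ring, ← h1, ← add_zero (∑ j ∈ Finset.range (k + 1),
      racahWeight j σ τ g * (wilsonHyp n (zSq j σ τ) (σ - τ) (σ + τ) g g *
        (nodeProd (σ - τ) (σ - τ + j) i * nodeProd (σ + τ) (σ - τ + j) (m + 1)))),
      ← mul_zero ((σ - τ + i) ^ 2 - (σ + τ + m) ^ 2), ← h2, Finset.mul_sum,
      ← Finset.sum_add_distrib]
    refine Finset.sum_congr rfl fun j _ => ?_
    rw [nodeProd_succ, nodeProd_succ]
    ring

/-- Expand the factor of lower degree in node products: only the top term, and only for equal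
degrees, survives. -/
theorem wilsonHyp_orthogonal (hg : 0 < g) (hσ : 0 < σ) (h : σ - τ + g = -k) {n m : ℕ} (hn : n ≤ k)
    (hm : m ≤ n) : ∑ j ∈ Finset.range (k + 1), racahWeight j σ τ g *
      (wilsonHyp n (zSq j σ τ) (σ - τ) (σ + τ) g g * wilsonHyp m (zSq j σ τ) (σ - τ) (σ + τ) g g) =
    if m = n then wilsonCoeff σ τ g n n * (racahSum σ τ g k 0 0 * (poch (σ + τ + g) n ^ 2 *
      (poch (2 * σ) n / poch (2 * σ + 2 * g) n) * (poch (2 * g) n * poch (-(n : ℝ)) n /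
        (poch (2 * σ) n * poch (2 * σ + 2 * g + n) n)))) else 0 := by
  have h1 : ∀ j ∈ Finset.range (k + 1), racahWeight j σ τ g *
      (wilsonHyp n (zSq j σ τ) (σ - τ) (σ + τ) g g * wilsonHyp m (zSq j σ τ) (σ - τ) (σ + τ) g g) =
      ∑ i ∈ Finset.range (m + 1), wilsonCoeff σ τ g m i * (racahWeight j σ τ g *
      (wilsonHyp n (zSq j σ τ) (σ - τ) (σ + τ) g g *
        (nodeProd (σ - τ) (σ - τ + j) i * nodeProd (σ + τ) (σ - τ + j) 0))) := by
    intro j _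
    rw [wilsonHyp_node σ τ g m, Finset.mul_sum, Finset.mul_sum]
    refine Finset.sum_congr rfl fun i _ => ?_
    rw [nodeProd, nodeProd, poch_zero, poch_zero]
    ring
  rw [Finset.sum_congr rfl h1, Finset.sum_comm]
  simp only [← Finset.mul_sum]
  have h2 : ∀ i ∈ Finset.range (m + 1), _ := fun i hi =>
    wilson_moment_mixed hg hσ h hn i 0 (by have := Finset.mem_range.1 hi; omega)
  rw [Finset.sum_congr rfl fun i hi => congrArg (wilsonCoeff σ τ g m i * ·) (h2 i hi),
    Finset.sum_range_succ, Finset.sum_eq_zero, zero_add]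
  · simp only [add_zero]
    split_ifs with hmn
    · rw [hmn]
    · simp
  · intro i hi
    rw [if_neg (by have := Finset.mem_range.1 hi; omega), mul_zero]

end Racah

/-! ### Normalization and positivity of the weight; orthonormality. -/

section Weight

variable {σ τ g : ℝ} {k : ℕ}

/-- The constant factor of the discrete weight. -/
noncomputable def qConst (σ τ g : ℝ) : ℝ :=
  -2 * (Real.Gamma (2 * σ + 2 * g) * Real.Gamma (2 * τ) * Real.Gamma (g - σ + τ) ^ 2 /
      (Real.Gamma (2 * τ - 2 * σ + 1) * Real.Gamma (2 * g) * Real.Gamma (g + σ + τ) ^ 2))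

theorem qSq_eq (j : ℕ) (σ τ g : ℝ) : qSq j σ τ g = qConst σ τ g * racahWeight j σ τ g := rfl

theorem qConst_neg (hg : 0 < g) (hσ : 0 < σ) (h : σ - τ + g = -k) : qConst σ τ g < 0 := by
  have hk : (0 : ℝ) ≤ k := by positivity
  have h1 := Real.Gamma_pos_of_pos (show 0 < 2 * σ + 2 * g by linarith)
  have h2 := Real.Gamma_pos_of_pos (show 0 < 2 * τ by linarith)
  have h3 := Real.Gamma_pos_of_pos (show 0 < g - σ + τ by linarith)
  have h4 := Real.Gamma_pos_of_pos (show 0 < 2 * τ - 2 * σ + 1 by linarith)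
  have h5 := Real.Gamma_pos_of_pos (show 0 < 2 * g by linarith)
  have h6 := Real.Gamma_pos_of_pos (show 0 < g + σ + τ by linarith)
  unfold qConst
  have : 0 < Real.Gamma (2 * σ + 2 * g) * Real.Gamma (2 * τ) * Real.Gamma (g - σ + τ) ^ 2 /
      (Real.Gamma (2 * τ - 2 * σ + 1) * Real.Gamma (2 * g) * Real.Gamma (g + σ + τ) ^ 2) := by
    positivity
  linarith

/-- Under $\sigma-\tau+\gamma=-k$ every Gamma argument differs by an integer from $2\gamma$ or
$2\sigma+2\gamma$, so the Gamma values reduce to Pochhammer symbols that match `racahSum_zero`. -/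
theorem qConst_mul_racahSum (hg : 0 < g) (hσ : 0 < σ) (h : σ - τ + g = -k) :
    qConst σ τ g * racahSum σ τ g k 0 0 = 1 := by
  have hk : (0 : ℝ) ≤ k := by positivity
  have hS := racahSum_zero hg hσ h
  have g1 : Real.Gamma (g - σ + τ) = poch (2 * g) k * Real.Gamma (2 * g) := by
    rw [← Gamma_add_nat (by linarith)]; congr 1; linarith
  have g2 : Real.Gamma (g + σ + τ) = poch (2 * σ + 2 * g) k * Real.Gamma (2 * σ + 2 * g) := by
    rw [← Gamma_add_nat (by linarith)]; congr 1; linarith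
  have g3 : Real.Gamma (2 * τ) = poch (2 * σ + 2 * g + k) k *
      (poch (2 * σ + 2 * g) k * Real.Gamma (2 * σ + 2 * g)) := by
    rw [← Gamma_add_nat (by linarith), ← Gamma_add_nat (by linarith)]; congr 1; linarith
  have g4 : Real.Gamma (2 * τ - 2 * σ + 1) = poch (2 * g + 1) (2 * k) *
      (2 * g * Real.Gamma (2 * g)) := by
    rw [← Real.Gamma_add_one (by linarith), ← Gamma_add_nat (by linarith)]
    congr 1; push_cast; linarith
  have p1 := poch_pos (show 0 < 2 * σ + 2 * g + k by linarith) k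
  have p2 := poch_pos (show 0 < 2 * g by linarith) k
  have p3 := poch_pos (show 0 < 2 * σ + 2 * g by linarith) k
  have p4 := poch_pos (show 0 < 2 * g + 1 by linarith) (2 * k)
  have q1 := Real.Gamma_pos_of_pos (show 0 < 2 * σ + 2 * g by linarith)
  have q2 := Real.Gamma_pos_of_pos (show 0 < 2 * g by linarith)
  rw [qConst, g1, g2, g3, g4]
  generalize poch (2 * σ + 2 * g + k) k = x1 at *
  generalize poch (2 * g) k = x2 at *
  generalize poch (2 * σ + 2 * g) k = x3 at *
  generalize poch (2 * g + 1) (2 * k) = x4 at *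
  generalize Real.Gamma (2 * σ + 2 * g) = y1 at *
  generalize Real.Gamma (2 * g) = y2 at *
  have hS' : racahSum σ τ g k 0 0 = -g * (x4 * x3) / (x1 * x2 ^ 2) := by
    rw [← hS]; field_simp
  rw [hS']
  field_simp

/-- The factors $(2\sigma-2\tau)_j$ and $(1-2\tau)_j$ both have sign $(-1)^j$, and the negative
$j+\sigma-\tau$ is compensated by the negative constant. -/
theorem qSq_pos (hg : 0 < g) (hσ : 0 < σ) (h : σ - τ + g = -k) {j : ℕ} (hj : j ≤ k) :
    0 < qSq j σ τ g := by
  have hjk : (j : ℝ) ≤ k := by exact_mod_cast hj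
  rw [qSq_eq]
  refine mul_pos_of_neg_of_neg (qConst_neg hg hσ h) ?_
  have h1 := neg_one_pow_mul_poch_pos (x := 2 * σ - 2 * τ) (n := j) (by linarith)
  have h2 := neg_one_pow_mul_poch_pos (x := 1 - 2 * τ) (n := j) (by linarith)
  have h3 := poch_pos (show 0 < 2 * σ by linarith) j
  have h4 : poch (σ - τ + g) j ≠ 0 := by rw [h]; exact poch_neg_nat_ne_zero hj
  have h5 : poch (σ - τ - g + 1) j ≠ 0 := poch_ne_zero_of_lt (by linarith)
  have hm : ((-1 : ℝ) ^ j) ≠ 0 := by simp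
  have h6 : poch (2 * σ - 2 * τ) j * poch (2 * σ) j * poch (σ - τ + g) j ^ 2 /
      (poch (1 - 2 * τ) j * poch (σ - τ - g + 1) j ^ 2 * (j ! : ℝ)) =
      ((-1) ^ j * poch (2 * σ - 2 * τ) j) * poch (2 * σ) j * poch (σ - τ + g) j ^ 2 /
      (((-1) ^ j * poch (1 - 2 * τ) j) * poch (σ - τ - g + 1) j ^ 2 * (j ! : ℝ)) := by
    rw [← mul_div_mul_left _ _ hm]
    congr 1 <;> ring
  unfold racahWeight
  rw [h6]
  refine mul_neg_of_neg_of_pos (by linarith) ?_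
  positivity

theorem qSq_eq_zero (h : σ - τ + g = -k) {j : ℕ} (hj : k < j) : qSq j σ τ g = 0 := by
  rw [qSq, h, poch_neg_nat_eq_zero hj]
  simp

/-- The normalization factor of the Wilson polynomial. -/
noncomputable def wilsonNorm (n : ℕ) (σ τ g : ℝ) : ℝ :=
  √((2 * n + 2 * σ + 2 * g - 1) / (n + 2 * σ + 2 * g - 1) *
      (poch (2 * σ) n * poch (2 * σ + 2 * g) n / (poch (2 * g) n * (n ! : ℝ)))) *
    (poch (σ - τ + g) n / poch (σ + τ + g) n)

theorem wilson_eq_norm_mul (n : ℕ) (t σ τ g : ℝ) :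
    wilson n t σ τ g = wilsonNorm n σ τ g * wilsonHyp n t (σ - τ) (σ + τ) g g := rfl

theorem wilsonNorm_sq (hg : 0 < g) (hσ : 1 / 2 ≤ σ) (n : ℕ) (τ : ℝ) : wilsonNorm n σ τ g ^ 2 =
    (2 * n + 2 * σ + 2 * g - 1) / (n + 2 * σ + 2 * g - 1) *
      (poch (2 * σ) n * poch (2 * σ + 2 * g) n / (poch (2 * g) n * (n ! : ℝ))) *
    (poch (σ - τ + g) n ^ 2 / poch (σ + τ + g) n ^ 2) := by
  have hn : (0 : ℝ) ≤ n := by positivity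
  have p1 := poch_pos (show 0 < 2 * σ by linarith) n
  have p2 := poch_pos (show 0 < 2 * g by linarith) n
  have p3 := poch_pos (show 0 < 2 * σ + 2 * g by linarith) n
  have h1 : 0 < 2 * n + 2 * σ + 2 * g - 1 := by linarith
  have h2 : 0 < n + 2 * σ + 2 * g - 1 := by linarith
  rw [wilsonNorm, mul_pow, Real.sq_sqrt (by positivity), div_pow]

/-- The Wilson polynomials are orthonormal with respect to the discrete weight. -/
theorem wilson_orthonormal (hg : 0 < g) (hσ : 1 / 2 ≤ σ) (h : σ - τ + g = -k) {N : ℕ} (hN : k ≤ N)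
    {n m : ℕ} (hn : n ≤ k) (hm : m ≤ k) :
    ∑ j ∈ Finset.range (N + 1), qSq j σ τ g * wilson n (zSq j σ τ) σ τ g *
      wilson m (zSq j σ τ) σ τ g = if n = m then 1 else 0 := by
  wlog hmn : m ≤ n generalizing n m with H
  · have := H hm hn (by omega)
    simp only [eq_comm (a := n)]
    rw [← this]
    exact Finset.sum_congr rfl fun j _ => by ring
  have hσ' : 0 < σ := by linarith
  have hk : (0 : ℝ) ≤ k := by positivity
  have h1 : ∑ j ∈ Finset.range (N + 1), qSq j σ τ g * wilson n (zSq j σ τ) σ τ g *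
      wilson m (zSq j σ τ) σ τ g = ∑ j ∈ Finset.range (k + 1),
        qSq j σ τ g * wilson n (zSq j σ τ) σ τ g * wilson m (zSq j σ τ) σ τ g := by
    symm
    refine Finset.sum_subset (Finset.range_mono (by omega)) fun j _ hj => ?_
    rw [qSq_eq_zero h (by have := Finset.mem_range.not.1 hj; omega)]
    ring
  have h2 : ∀ j ∈ Finset.range (k + 1), qSq j σ τ g * wilson n (zSq j σ τ) σ τ g *
      wilson m (zSq j σ τ) σ τ g = qConst σ τ g * wilsonNorm n σ τ g * wilsonNorm m σ τ g *
      (racahWeight j σ τ g * (wilsonHyp n (zSq j σ τ) (σ - τ) (σ + τ) g g *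
        wilsonHyp m (zSq j σ τ) (σ - τ) (σ + τ) g g)) := by
    intro j _
    rw [qSq_eq, wilson_eq_norm_mul, wilson_eq_norm_mul]; ring
  rw [h1, Finset.sum_congr rfl h2, ← Finset.mul_sum, wilsonHyp_orthogonal hg hσ' h hn hmn]
  rcases eq_or_ne m n with rfl | hne
  swap
  · rw [if_neg hne, if_neg hne.symm, mul_zero]
  rw [if_pos rfl, if_pos rfl, mul_assoc, mul_assoc, ← mul_assoc (wilsonNorm m σ τ g), ← pow_two,
    wilsonNorm_sq hg hσ, wilsonCoeff, poch_neg_self]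
  have hS := qConst_mul_racahSum hg hσ' h
  have hm0 : (0 : ℝ) ≤ m := by positivity
  have p1 := poch_pos (show 0 < 2 * σ by linarith) m
  have p2 := poch_pos (show 0 < 2 * g by linarith) m
  have p3 := poch_pos (show 0 < 2 * σ + 2 * g by linarith) m
  have p4 := poch_pos (show 0 < 2 * σ + 2 * g + m by linarith) m
  have p5 := poch_pos (show 0 < σ + τ + g by linarith) m
  have p6 : poch (σ - τ + g) m ≠ 0 := by rw [h]; exact poch_neg_nat_ne_zero hm
  have q1 : 0 < 2 * m + 2 * σ + 2 * g - 1 := by linarith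
  have q2 : 0 < m + 2 * σ + 2 * g - 1 := by linarith
  have hf : (0 : ℝ) < (m ! : ℝ) := by positivity
  have hsgn : ((-1 : ℝ) ^ m) ^ 2 = 1 := by rw [← pow_mul, mul_comm, pow_mul]; simp
  -- The leading coefficient has $(m+2\sigma+2\gamma-1)_m$, the moment $(2\sigma+2\gamma+m)_m$.
  -- Their ratio is inverse to the first quotient under the square root of the normalization.
  have hsh := (poch_succ (m + 2 * σ + 2 * g - 1) m).symm.trans (poch_succ_left _ m)
  rw [show (m : ℝ) + 2 * σ + 2 * g - 1 + 1 = 2 * σ + 2 * g + m by ring,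
    show (m : ℝ) + 2 * σ + 2 * g - 1 + m = 2 * m + 2 * σ + 2 * g - 1 by ring] at hsh
  have e : poch (m + 2 * σ + 2 * g - 1) m = (m + 2 * σ + 2 * g - 1) * poch (2 * σ + 2 * g + m) m /
      (2 * m + 2 * σ + 2 * g - 1) := by rw [← hsh, mul_div_cancel_right₀ _ q1.ne']
  rw [e]
  clear e hsh h2 h1
  generalize poch (2 * σ) m = x1 at *
  generalize poch (2 * g) m = x2 at *
  generalize poch (2 * σ + 2 * g) m = x3 at *
  generalize poch (2 * σ + 2 * g + m) m = x4 at *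
  generalize poch (σ + τ + g) m = x5 at *
  generalize poch (σ - τ + g) m = x6 at *
  generalize 2 * (m : ℝ) + 2 * σ + 2 * g - 1 = y1 at *
  generalize (m : ℝ) + 2 * σ + 2 * g - 1 = y2 at *
  generalize racahSum σ τ g k 0 0 = S at *
  generalize qConst σ τ g = Q at *
  generalize (-1 : ℝ) ^ m = ε at *
  generalize (m ! : ℝ) = f at *
  field_simp
  linear_combination ε ^ 2 * hS + hsgn

end Weight

/-! ### Jacobi polynomials and the closed form of the expansion. -/

open Polynomial in
/-- The terminating series `₂F₁(-n, b; c; X)`. -/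
noncomputable def hypPoly (n : ℕ) (b c : ℝ) : ℝ[X] :=
  ∑ j ∈ Finset.range (n + 1),
    Polynomial.monomial j (poch (-(n : ℝ)) j * poch b j / (poch c j * (j ! : ℝ)))

theorem hypPoly_coeff (n : ℕ) (b c : ℝ) (j : ℕ) :
    (hypPoly n b c).coeff j = poch (-(n : ℝ)) j * poch b j / (poch c j * (j ! : ℝ)) := by
  rw [hypPoly, Polynomial.finsetSum_coeff]
  simp only [Polynomial.coeff_monomial]
  rw [Finset.sum_ite_eq']
  split_ifs with h
  · rfl
  · rw [poch_neg_nat_eq_zero (by have := Finset.mem_range.not.1 h; omega)]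
    simp

theorem hypPoly_coeff_succ (n : ℕ) (b : ℝ) {c : ℝ} (hc : 0 < c) (j : ℕ) :
    (hypPoly n b c).coeff (j + 1) * ((j + 1) * (c + j)) =
      (hypPoly n b c).coeff j * ((-n + j) * (b + j)) := by
  have h1 := poch_pos hc j
  have h2 : 0 < c + j := by positivity
  have h3 : (0 : ℝ) < (j ! : ℝ) := by positivity
  rw [hypPoly_coeff, hypPoly_coeff, poch_succ, poch_succ, poch_succ, Nat.factorial_succ]
  push_cast
  field_simp

-- Comparing coefficients gives the two-term relation `hypPoly_coeff_succ`; degrees 0 and 1 are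
-- separate because of the factors `X` and `X * X`.
open Polynomial in
theorem hypPoly_ode (n : ℕ) (b : ℝ) {c : ℝ} (hc : 0 < c) :
    X * (1 - X) * derivative (derivative (hypPoly n b c)) +
      (C c - C (-n + b + 1) * X) * derivative (hypPoly n b c) -
        C (-n * b) * hypPoly n b c = 0 := by
  have e : X * (1 - X) * derivative (derivative (hypPoly n b c)) +
      (C c - C (-n + b + 1) * X) * derivative (hypPoly n b c) -
        C (-n * b) * hypPoly n b c = X * derivative (derivative (hypPoly n b c)) -
      X * (X * derivative (derivative (hypPoly n b c))) + C c * derivative (hypPoly n b c) -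
      C (-n + b + 1) * (X * derivative (hypPoly n b c)) - C (-n * b) * hypPoly n b c := by ring
  rw [e]
  ext j
  have h := hypPoly_coeff_succ n b hc j
  rcases j with _ | j
  · simp [coeff_derivative] at h ⊢
    linear_combination h
  · rcases j with _ | j
    · simp only [coeff_add, coeff_sub, coeff_C_mul, coeff_X_mul, coeff_derivative, coeff_zero,
        mul_coeff_zero, coeff_X_zero] at h ⊢
      push_cast at h ⊢
      linear_combination h
    · simp only [coeff_add, coeff_sub, coeff_C_mul, coeff_X_mul, coeff_derivative, coeff_zero] at h ⊢
      push_cast at h ⊢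
      linear_combination h

theorem hypPoly_eval (n : ℕ) (b c x : ℝ) :
    ordinaryHypergeometric (-(n : ℝ)) b c x = (hypPoly n b c).eval x := by
  rw [ordinaryHypergeometric_eq_tsum]
  simp only
  rw [tsum_eq_sum (s := Finset.range (n + 1)), hypPoly, Polynomial.eval_finsetSum]
  · refine Finset.sum_congr rfl fun j _ => ?_
    rw [Polynomial.eval_monomial]
    simp only [poch, smul_eq_mul]
    ring
  · intro j hj
    have h := poch_neg_nat_eq_zero (k := n) (n := j)
      (by have := Finset.mem_range.not.1 hj; omega)
    rw [poch] at h
    simp [h]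

theorem hypPoly_eval_zero (n : ℕ) (b c : ℝ) : (hypPoly n b c).eval 0 = 1 := by
  rw [← Polynomial.coeff_zero_eq_eval_zero, hypPoly_coeff]
  simp [poch_zero]

/-- The Christoffel–Darboux sum of Jacobi polynomials at an endpoint. -/
theorem jacobi_kernel {μ ν : ℝ} (hμ : -1 < μ) (hν : 0 ≤ ν) (k : ℕ) :
    ∑ n ∈ Finset.range (k + 1), Polynomial.C ((2 * n + μ + ν + 1) * (poch (μ + ν + 1) n *
      poch (μ + 1) n / (poch (ν + 1) n * (n ! : ℝ)))) * hypPoly n (n + μ + ν + 1) (μ + 1) =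
    Polynomial.C (poch (μ + ν + 1) (k + 1) * poch (μ + 2) k / (poch (ν + 1) k * (k ! : ℝ))) *
      hypPoly k (k + μ + ν + 2) (μ + 2) := by
  induction k with
  | zero =>
    simp [hypPoly, poch_zero, poch_succ]
  | succ k ih =>
    rw [Finset.sum_range_succ, ih]
    ext j
    simp only [Polynomial.coeff_add, Polynomial.coeff_C_mul, hypPoly_coeff]
    -- The three shift relations write the kernels of degrees `k` and `k + 1` and the new summand
    -- with the same Pochhammer symbols in `j`, so a rational identity remains.
    have h1 : poch (-((k + 1 : ℕ) : ℝ)) j * (-(k + 1) + j) = -(k + 1) * poch (-(k : ℝ)) j := by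
      have := (poch_succ (-((k + 1 : ℕ) : ℝ)) j).symm.trans (poch_succ_left _ j)
      push_cast at this ⊢
      rw [show -((k : ℝ) + 1) + 1 = -k by ring] at this
      exact this
    have h2 : poch (k + μ + ν + 2) j * (k + μ + ν + 2 + j) =
        (k + μ + ν + 2) * poch (k + μ + ν + 3) j := by
      have := (poch_succ (k + μ + ν + 2) j).symm.trans (poch_succ_left _ j)
      rwa [show (k : ℝ) + μ + ν + 2 + 1 = k + μ + ν + 3 by ring] at this
    have h3 : poch (μ + 1) j * (μ + 1 + j) = (μ + 1) * poch (μ + 2) j := by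
      have := (poch_succ (μ + 1) j).symm.trans (poch_succ_left _ j)
      rwa [show μ + 1 + 1 = μ + 2 by ring] at this
    have hk0 : (0 : ℝ) ≤ k := by positivity
    have hj0 : (0 : ℝ) ≤ j := by positivity
    have c1 : 0 < (k : ℝ) + 1 := by positivity
    have c2 : 0 < k + μ + ν + 2 := by linarith
    have c3 : 0 < μ + 1 := by linarith
    have c4 : 0 < ν + 1 + k := by linarith
    have c5 : 0 < μ + 1 + j := by linarith
    have p1 := poch_pos (show 0 < ν + 1 by linarith) k
    have p2 := poch_pos (show 0 < μ + 1 by linarith) j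
    have p3 := poch_pos (show 0 < μ + 2 by linarith) j
    have hf : (0 : ℝ) < (k ! : ℝ) := by positivity
    have hfj : (0 : ℝ) < (j ! : ℝ) := by positivity
    have e1 : poch (-(k : ℝ)) j = poch (-((k + 1 : ℕ) : ℝ)) j * (k + 1 - j) / (k + 1) := by
      field_simp; linear_combination h1
    have e2 : poch (k + μ + ν + 3) j =
        poch (k + μ + ν + 2) j * (k + μ + ν + 2 + j) / (k + μ + ν + 2) := by
      rw [h2, mul_div_cancel_left₀ _ c2.ne']
    have e3 : poch (μ + 2) j = poch (μ + 1) j * (μ + 1 + j) / (μ + 1) := by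
      rw [h3, mul_div_cancel_left₀ _ c3.ne']
    rw [show ((k + 1 : ℕ) : ℝ) + μ + ν + 1 = k + μ + ν + 2 by push_cast; ring,
      show ((k + 1 : ℕ) : ℝ) + μ + ν + 2 = k + μ + ν + 3 by push_cast; ring,
      poch_succ_left (μ + 1) k, poch_succ (μ + ν + 1) (k + 1), poch_succ (ν + 1), poch_succ (μ + 2) k,
      e1, e2, e3, Nat.factorial_succ, show μ + 1 + 1 = μ + 2 by ring]
    push_cast
    rw [show μ + ν + 1 + ((k : ℝ) + 1) = k + μ + ν + 2 by ring]
    clear h1 h2 h3 e1 e2 e3 ih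
    generalize poch (-((k : ℝ) + 1)) j = x1
    generalize poch (k + μ + ν + 2) j = x2
    generalize poch (μ + 1) j = x3 at *
    generalize poch (ν + 1) k = x4 at *
    generalize poch (μ + ν + 1) (k + 1) = x5 at *
    generalize poch (μ + 2) k = x6 at *
    generalize (k ! : ℝ) = x7 at *
    generalize (j ! : ℝ) = x8 at *
    obtain ⟨q, hq⟩ : ∃ q, q = k + μ + ν + 2 := ⟨_, rfl⟩
    obtain ⟨r, hr⟩ : ∃ r, r = μ + 1 + (j : ℝ) := ⟨_, rfl⟩
    obtain ⟨t, ht⟩ : ∃ t, t = ν + 1 + (k : ℝ) := ⟨_, rfl⟩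
    obtain ⟨w, hw⟩ : ∃ w, w = μ + 1 := ⟨_, rfl⟩
    obtain ⟨l, hl⟩ : ∃ l, l = (k : ℝ) + 1 := ⟨_, rfl⟩
    rw [← hq] at c2 ⊢
    rw [← hr] at c5 ⊢
    rw [← ht] at c4 ⊢
    rw [← hw] at c3 ⊢
    rw [← hl] at c1 ⊢
    field_simp
    subst hq hr ht hw hl
    ring

theorem sqrt_mul_sq_eq {X x K : ℝ} (hx : 0 ≤ x) (h : X = K * x ^ 2) : √X = √K * x := by
  rw [h, Real.sqrt_mul' _ (sq_nonneg x), Real.sqrt_sq hx]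

/-- Up to a constant, `wilsonEnd n` is `jacobiNorm n` times the endpoint value $(\mu+1)_n/n!$; the
product is therefore rational in `n` and Pochhammer symbols, and it supplies the coefficients of
`jacobi_kernel`. -/
theorem wilsonEnd_mul_jacobiNorm {μ ν : ℝ} (hμ : -1 < μ) (hν : 0 ≤ ν) (n : ℕ) :
    wilsonEnd n μ ν * jacobiNorm n μ ν =
      √(Real.Gamma (μ + ν + 1) / ((μ + ν + 1) * Real.Gamma (μ + 1) * Real.Gamma (ν + 1))) *
        ((2 * n + μ + ν + 1) * poch (μ + ν + 1) n / poch (ν + 1) n) := by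
  have hn : (0 : ℝ) ≤ n := by positivity
  have p0 := poch_pos (show 0 < μ + ν + 1 by linarith) n
  have p1 := poch_pos (show 0 < μ + 1 by linarith) n
  have p2 := poch_pos (show 0 < μ + ν + 2 by linarith) n
  have p3 := poch_pos (show 0 < ν + 1 by linarith) n
  have c1 : 0 < 2 * n + μ + ν + 1 := by linarith
  have c2 : 0 < n + μ + ν + 1 := by linarith
  have c3 : 0 < μ + ν + 1 := by linarith
  have g1 := Real.Gamma_pos_of_pos (show 0 < μ + 1 by linarith)
  have g2 := Real.Gamma_pos_of_pos (show 0 < ν + 1 by linarith)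
  have g3 := Real.Gamma_pos_of_pos (show 0 < μ + ν + 1 by linarith)
  have e1 : Real.Gamma (n + μ + 1) = poch (μ + 1) n * Real.Gamma (μ + 1) := by
    rw [← Gamma_add_nat (by linarith)]; congr 1; ring
  have e2 : Real.Gamma (n + ν + 1) = poch (ν + 1) n * Real.Gamma (ν + 1) := by
    rw [← Gamma_add_nat (by linarith)]; congr 1; ring
  have e3 : Real.Gamma (n + μ + ν + 1) = poch (μ + ν + 1) n * Real.Gamma (μ + ν + 1) := by
    rw [← Gamma_add_nat (by linarith)]; congr 1; ring
  have e4 : poch (μ + ν + 2) n = poch (μ + ν + 1) n * (n + μ + ν + 1) / (μ + ν + 1) := by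
    have := (poch_succ (μ + ν + 1) n).symm.trans (poch_succ_left _ n)
    rw [show μ + ν + 1 + 1 = μ + ν + 2 by ring] at this
    rw [eq_div_iff c3.ne']
    linear_combination -this
  have hf : (0 : ℝ) < (n ! : ℝ) := by positivity
  rw [wilsonEnd, jacobiNorm, ← Real.sqrt_mul (by positivity)]
  refine sqrt_mul_sq_eq (by positivity) ?_
  rw [e1, e2, e3, e4, Real.Gamma_nat_eq_factorial]
  generalize poch (μ + ν + 1) n = x1 at *
  generalize poch (μ + 1) n = x2 at *
  generalize poch (ν + 1) n = x3 at *
  generalize 2 * (n : ℝ) + μ + ν + 1 = y1 at *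
  generalize (n : ℝ) + μ + ν + 1 = y2 at *
  generalize Real.Gamma (μ + 1) = z1 at *
  generalize Real.Gamma (ν + 1) = z2 at *
  generalize Real.Gamma (μ + ν + 1) = z3 at *
  field_simp

/-- The coefficient in front of the closed form of the expansion in Jacobi polynomials. -/
noncomputable def kernelConst (k : ℕ) (μ ν : ℝ) : ℝ :=
  √(Real.Gamma (μ + ν + 1) / ((μ + ν + 1) * Real.Gamma (μ + 1) * Real.Gamma (ν + 1))) *
    (poch (μ + ν + 1) (k + 1) * poch (μ + 2) k / (poch (ν + 1) k * (k ! : ℝ)))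

theorem kernelConst_pos {μ ν : ℝ} (hμ : -1 < μ) (hν : 0 ≤ ν) (k : ℕ) : 0 < kernelConst k μ ν := by
  have p0 := poch_pos (show 0 < μ + ν + 1 by linarith) (k + 1)
  have p1 := poch_pos (show 0 < μ + 2 by linarith) k
  have p3 := poch_pos (show 0 < ν + 1 by linarith) k
  have c3 : 0 < μ + ν + 1 := by linarith
  have g1 := Real.Gamma_pos_of_pos (show 0 < μ + 1 by linarith)
  have g2 := Real.Gamma_pos_of_pos (show 0 < ν + 1 by linarith)
  have g3 := Real.Gamma_pos_of_pos (show 0 < μ + ν + 1 by linarith)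
  unfold kernelConst
  positivity

theorem sum_wilsonEnd_mul_phi {μ ν : ℝ} (hμ : -1 < μ) (hν : 0 ≤ ν) (k : ℕ) (α β γ d x : ℝ) :
    ∑ n ∈ Finset.range (k + 1), wilsonEnd n μ ν * phi n α β γ d μ ν x =
      kernelConst k μ ν * (|x| ^ α * |x - 1| ^ β * |x - d| ^ γ *
        (hypPoly k (k + μ + ν + 2) (μ + 2)).eval (1 - x)) := by
  have h := congrArg (Polynomial.eval (1 - x)) (jacobi_kernel hμ hν k)
  simp only [Polynomial.eval_finsetSum, Polynomial.eval_mul, Polynomial.eval_C] at h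
  rw [kernelConst, mul_mul_mul_comm, ← mul_assoc,
    mul_assoc (√_ * (|x| ^ α * |x - 1| ^ β * |x - d| ^ γ)), ← h, Finset.mul_sum]
  refine Finset.sum_congr rfl fun n _ => ?_
  have h1 := wilsonEnd_mul_jacobiNorm hμ hν n
  have g1 := Real.Gamma_pos_of_pos (show 0 < μ + 1 by linarith)
  have e1 : Real.Gamma (n + μ + 1) = poch (μ + 1) n * Real.Gamma (μ + 1) := by
    rw [← Gamma_add_nat (by linarith)]; congr 1; ring
  rw [phi, jacobiP, hypPoly_eval, e1, Real.Gamma_nat_eq_factorial]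
  have e2 : poch (μ + 1) n * Real.Gamma (μ + 1) / ((n ! : ℝ) * Real.Gamma (μ + 1)) =
      poch (μ + 1) n / (n ! : ℝ) := by field_simp
  rw [e2]
  linear_combination (|x| ^ α * |x - 1| ^ β * |x - d| ^ γ * (poch (μ + 1) n / (n ! : ℝ) *
    (hypPoly n (n + μ + ν + 1) (μ + 1)).eval (1 - x))) * h1

/-! ### The Heun-type equation after removal of the prefactor. -/

theorem hasDerivAt_abs_sub_rpow (e p : ℝ) {x : ℝ} (hx : x ≠ e) :
    HasDerivAt (fun x => |x - e| ^ p) (|x - e| ^ p * (p / (x - e))) x := by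
  have hx' : x - e ≠ 0 := sub_ne_zero.2 hx
  have h1 : HasDerivAt (fun x => x - e) 1 x := (hasDerivAt_id x).sub_const e
  have h3 : HasDerivAt (fun x => |x - e|) ((SignType.sign (x - e) : ℝ) * 1) x :=
    HasDerivAt.comp (h₂ := fun x => |x|) x (hasDerivAt_abs hx') h1
  have h2 := h3.rpow_const (p := p) (Or.inl (abs_ne_zero.2 hx'))
  refine h2.congr_deriv ?_
  rw [Real.rpow_sub_one (abs_ne_zero.2 hx')]
  rcases lt_or_gt_of_ne hx' with h | h
  · rw [sign_neg h, abs_of_neg h]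
    generalize (-(x - e)) ^ p = w
    generalize x - e = z at *
    simp
    field_simp
  · rw [sign_pos h, abs_of_pos h]
    simp
    field_simp

theorem contDiffAt_abs_sub_rpow (e p : ℝ) {x : ℝ} (hx : x ≠ e) :
    ContDiffAt ℝ 2 (fun x => |x - e| ^ p) x := by
  have hx' : x - e ≠ 0 := sub_ne_zero.2 hx
  have h1 : ContDiffAt ℝ 2 (fun x : ℝ => x - e) x := by fun_prop
  exact (h1.abs hx').rpow_const_of_ne (abs_ne_zero.2 hx')

/-- The potential of the Heun-type equation after conjugation by the prefactor. -/
theorem heun_potential {α β δ μ ν d x : ℝ} (h0 : x ≠ 0) (h1 : x ≠ 1)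
    (hd : x ≠ d) :
    (α / x + β / (x - 1) + δ / (x - d)) ^ 2 -
      (α / x ^ 2 + β / (x - 1) ^ 2 + δ / (x - d) ^ 2) +
      ((ν + 1 - 2 * α) / x + (μ + 2 - 2 * β) / (x - 1) + (-2 * δ) / (x - d)) *
        (α / x + β / (x - 1) + δ / (x - d)) +
      1 / (x * (x - 1) * (x - d)) * (d * (α ^ 2 - α * ν) / x +
        (1 - d) * (β ^ 2 - β * (μ + 1)) / (x - 1) + (-δ * (1 + δ) * d * (1 - d)) / (x - d) -
        ((α ^ 2 - α * ν) - (β ^ 2 - β * (μ + 1)) + δ * (d * ((ν + 1 - 2 * α) + (μ + 2 - 2 * β) -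
          2 * δ - 2) + 1 - (ν + 1 - 2 * α) + δ))) =
    -((α + β + δ) * (α + β + δ - μ - ν - 2)) / (x * (x - 1)) := by
  have h1' : x - 1 ≠ 0 := sub_ne_zero.2 h1
  have hd' : x - d ≠ 0 := sub_ne_zero.2 hd
  field_simp
  ring

/-- The common prefactor of the basis functions. -/
noncomputable def prefactor (α β δ d x : ℝ) : ℝ := |x| ^ α * |x - 1| ^ β * |x - d| ^ δ

theorem hasDerivAt_prefactor (α β δ : ℝ) {d x : ℝ} (h0 : x ≠ 0) (h1 : x ≠ 1) (hd : x ≠ d) :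
    HasDerivAt (prefactor α β δ d)
      (prefactor α β δ d x * (α / x + β / (x - 1) + δ / (x - d))) x := by
  have e0 := hasDerivAt_abs_sub_rpow 0 α h0
  simp only [sub_zero] at e0
  have e := (e0.mul (hasDerivAt_abs_sub_rpow 1 β h1)).mul (hasDerivAt_abs_sub_rpow d δ hd)
  refine e.congr_deriv ?_
  simp only [prefactor, Pi.mul_apply]
  ring

theorem contDiffAt_prefactor (α β δ : ℝ) {d x : ℝ} (h0 : x ≠ 0) (h1 : x ≠ 1) (hd : x ≠ d) :
    ContDiffAt ℝ 2 (prefactor α β δ d) x := by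
  have e0 := contDiffAt_abs_sub_rpow 0 α h0
  simp only [sub_zero] at e0
  exact (e0.mul (contDiffAt_abs_sub_rpow 1 β h1)).mul (contDiffAt_abs_sub_rpow d δ hd)

theorem hasDerivAt_eval_one_sub (P : Polynomial ℝ) (x : ℝ) :
    HasDerivAt (fun x => P.eval (1 - x)) (-(Polynomial.derivative P).eval (1 - x)) x := by
  have h1 : HasDerivAt (fun x : ℝ => 1 - x) (-1) x := by
    simpa using (hasDerivAt_id x).const_sub 1
  have h2 := (P.hasDerivAt (1 - x)).comp x h1
  refine h2.congr_deriv ?_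
  ring

/-- A Jacobi polynomial times the prefactor solves the restricted Heun-type equation. -/
theorem isHeunSolution_prefactor_mul {α β δ μ ν d : ℝ} (k : ℕ) (K : ℝ) (hμ : -1 < μ)
    (hk : k * (k + μ + ν + 2) = (α + β + δ) * (α + β + δ - μ - ν - 2)) :
    IsHeunSolution (ν + 1 - 2 * α) (μ + 2 - 2 * β) (-2 * δ) d (d * (α ^ 2 - α * ν))
      ((1 - d) * (β ^ 2 - β * (μ + 1))) (-δ * (1 + δ) * d * (1 - d)) 0
      ((α ^ 2 - α * ν) - (β ^ 2 - β * (μ + 1)) + δ * (d * ((ν + 1 - 2 * α) + (μ + 2 - 2 * β) -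
          2 * δ - 2) + 1 - (ν + 1 - 2 * α) + δ))
      (fun x => K * (prefactor α β δ d x *
        (hypPoly k (k + μ + ν + 2) (μ + 2)).eval (1 - x))) := by
  intro x h0 h1 hd
  set P := hypPoly k (k + μ + ν + 2) (μ + 2) with hP
  set M := prefactor α β δ d with hM
  have hMd : ∀ x, x ≠ 0 → x ≠ 1 → x ≠ d → HasDerivAt M
      (M x * (α / x + β / (x - 1) + δ / (x - d))) x :=
    fun x h0 h1 hd => hasDerivAt_prefactor α β δ h0 h1 hd
  have hy1 : ∀ x, x ≠ 0 → x ≠ 1 → x ≠ d → HasDerivAt (fun x => K * (M x * P.eval (1 - x)))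
      (K * (M x * ((α / x + β / (x - 1) + δ / (x - d)) * P.eval (1 - x) -
        (Polynomial.derivative P).eval (1 - x)))) x := by
    intro x h0 h1 hd
    refine (((hMd x h0 h1 hd).mul (hasDerivAt_eval_one_sub P x)).const_mul K).congr_deriv ?_
    ring
  have hr : HasDerivAt (fun x => α / x + β / (x - 1) + δ / (x - d))
      (-(α / x ^ 2 + β / (x - 1) ^ 2 + δ / (x - d) ^ 2)) x := by
    have f : ∀ e p : ℝ, x ≠ e → HasDerivAt (fun x => p / (x - e)) (-(p / (x - e) ^ 2)) x := by
      intro e p hx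
      have := (((hasDerivAt_id x).sub_const e).inv (sub_ne_zero.2 hx)).const_mul p
      refine this.congr_deriv ?_
      simp only [id]
      ring
    have f0 := f 0 α h0
    simp only [sub_zero] at f0
    refine ((f0.add (f 1 β h1)).add (f d δ hd)).congr_deriv ?_
    ring
  have hy2 : HasDerivAt (fun x => K * (M x * ((α / x + β / (x - 1) + δ / (x - d)) *
      P.eval (1 - x) - (Polynomial.derivative P).eval (1 - x))))
      (K * (M x * (((α / x + β / (x - 1) + δ / (x - d)) ^ 2 -
        (α / x ^ 2 + β / (x - 1) ^ 2 + δ / (x - d) ^ 2)) * P.eval (1 - x) -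
        2 * (α / x + β / (x - 1) + δ / (x - d)) * (Polynomial.derivative P).eval (1 - x) +
        (Polynomial.derivative (Polynomial.derivative P)).eval (1 - x)))) x := by
    refine (((hMd x h0 h1 hd).mul ((hr.mul (hasDerivAt_eval_one_sub P x)).sub
      (hasDerivAt_eval_one_sub (Polynomial.derivative P) x))).const_mul K).congr_deriv ?_
    simp only [Pi.mul_apply, Pi.sub_apply]
    ring
  have hev : deriv (fun x => K * (M x * P.eval (1 - x))) =ᶠ[nhds x]
      fun x => K * (M x * ((α / x + β / (x - 1) + δ / (x - d)) *
        P.eval (1 - x) - (Polynomial.derivative P).eval (1 - x))) := by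
    filter_upwards [isOpen_ne.mem_nhds h0, isOpen_ne.mem_nhds h1, isOpen_ne.mem_nhds hd]
      with y h0 h1 hd
    exact (hy1 y h0 h1 hd).deriv
  refine ⟨?_, ?_⟩
  · have hp : ContDiffAt ℝ 2 (fun x : ℝ => P.eval (1 - x)) x :=
      by
      have h := (P.contDiff_aeval (𝕜 := ℝ) 2).contDiffAt.comp x
        (show ContDiffAt ℝ 2 (fun x : ℝ => 1 - x) x by fun_prop)
      simpa [Function.comp_def] using h
    exact contDiffAt_const.mul ((contDiffAt_prefactor α β δ h0 h1 hd).mul hp)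
  · rw [hev.deriv_eq, hy2.deriv, (hy1 x h0 h1 hd).deriv, mul_zero, add_zero]
    have hpot := heun_potential (α := α) (β := β) (δ := δ) (μ := μ) (ν := ν) h0 h1 hd
    have hode := congrArg (Polynomial.eval (1 - x))
      (hypPoly_ode k (k + μ + ν + 2) (show 0 < μ + 2 by linarith))
    rw [← hP] at hode
    simp only [Polynomial.eval_add, Polynomial.eval_sub, Polynomial.eval_mul, Polynomial.eval_X,
      Polynomial.eval_C, Polynomial.eval_one, Polynomial.eval_zero] at hode
    have h1' : x - 1 ≠ 0 := sub_ne_zero.2 h1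
    have hd' : x - d ≠ 0 := sub_ne_zero.2 hd
    rw [← hk] at hpot
    have hode' : (Polynomial.derivative (Polynomial.derivative P)).eval (1 - x) =
        ((ν + 1) / x + (μ + 2) / (x - 1)) * (Polynomial.derivative P).eval (1 - x) +
        k * (k + μ + ν + 2) / (x * (x - 1)) * P.eval (1 - x) := by
      field_simp
      linear_combination -hode
    -- The conjugated first-order coefficient loses its pole at `d` and is that of a Jacobi equation
    -- with $\mu$ raised by one, which is the reason for `μ + 2` in the polynomial.
    have hlin : (ν + 1) / x + (μ + 2) / (x - 1) = 2 * (α / x + β / (x - 1) + δ / (x - d)) +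
      ((ν + 1 - 2 * α) / x + (μ + 2 - 2 * β) / (x - 1) + (-2 * δ) / (x - d)) := by ring
    rw [hlin] at hode'
    linear_combination (K * M x * P.eval (1 - x)) * hpot + K * M x * hode'

theorem IsHeunSolution.heunH_eq {a b c d A B C D E : ℝ} {y : ℝ → ℝ}
    (h : IsHeunSolution a b c d A B C D E y) {x : ℝ} (h0 : x ≠ 0) (h1 : x ≠ 1) (hd : x ≠ d) :
    heunH a b c d A B C D y x = E * y x := by
  have h2 := (h x h0 h1 hd).2
  have h1' : x - 1 ≠ 0 := sub_ne_zero.2 h1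
  have hd' : x - d ≠ 0 := sub_ne_zero.2 hd
  have hne : x * (x - 1) * (x - d) ≠ 0 := mul_ne_zero (mul_ne_zero h0 h1') hd'
  have h3 : x * (x - 1) * (x - d) * (1 / (x * (x - 1) * (x - d))) = 1 := mul_one_div_cancel hne
  rw [heunH]
  linear_combination x * (x - 1) * (x - d) * h2 -
    ((A / x + B / (x - 1) + C / (x - d) + x * D - E) * y x) * h3

/-- A nonzero polynomial has finitely many roots, whereas the interval is infinite. -/
theorem exists_eval_ne_zero {P : Polynomial ℝ} (hP : P.eval 0 ≠ 0) (d : ℝ) :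
    ∃ x : ℝ, 0 < x ∧ x < 1 ∧ x ≠ d ∧ P.eval (1 - x) ≠ 0 := by
  have hP0 : P ≠ 0 := by rintro rfl; simp at hP
  have hfin : ({x | P.IsRoot x} ∪ {1 - d}).Finite :=
    (Polynomial.finite_setOfPred_isRoot hP0).union (Set.finite_singleton _)
  obtain ⟨z, hz, hz'⟩ := (Set.Ioo_infinite (show (0 : ℝ) < 1 by norm_num)).exists_notMem_finite hfin
  simp only [Set.mem_union, Set.mem_ofPred_eq, Set.mem_singleton_iff, not_or] at hz'
  refine ⟨1 - z, by linarith [hz.2], by linarith [hz.1], fun h => hz'.2 (by linarith), ?_⟩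
  simpa using hz'.1

/-! ### Quantization of `B` and the eigenfunctions. -/

theorem neg_one_lt_muPar {b d B : ℝ} (hB : 4 * B / (1 - d) < (1 - b) ^ 2) : -1 < muPar b d B := by
  have := Real.sqrt_pos.2 (sub_pos.2 hB)
  unfold muPar
  linarith

theorem muPar_add_one_sq {b d B : ℝ} (hB : 4 * B / (1 - d) < (1 - b) ^ 2) :
    (muPar b d B + 1) ^ 2 = (1 - b) ^ 2 - 4 * B / (1 - d) := by
  rw [muPar, sub_add_cancel, Real.sq_sqrt (sub_pos.2 hB).le]

theorem four_mul_quantizedB (a b c A : ℝ) {d : ℝ} (hd1 : d ≠ 1) (k : ℕ) :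
    4 * quantizedB a b c d A k / (1 - d) =
      (1 - b) ^ 2 - (2 * (k + sigmaPar a d A - tauPar a b c)) ^ 2 := by
  have : 1 - d ≠ 0 := sub_ne_zero.2 hd1.symm
  rw [quantizedB, sigmaPar, tauPar, nuPar]
  field_simp
  ring

theorem quantizedB_lt {a c d A : ℝ} (b : ℝ) (hd1 : d ≠ 1) {k : ℕ}
    (hk : (k : ℝ) < tauPar a b c - sigmaPar a d A) :
    4 * quantizedB a b c d A k / (1 - d) < (1 - b) ^ 2 := by
  rw [four_mul_quantizedB a b c A hd1]
  have : k + sigmaPar a d A - tauPar a b c ≠ 0 := by apply ne_of_lt; linarith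
  have : 0 < (2 * (k + sigmaPar a d A - tauPar a b c)) ^ 2 := by positivity
  linarith

/-- The condition $k<\tau-\sigma$ selects the sign of the square root of the perfect square; beyond
it $\sigma-\tau+\gamma$ would no longer be $-k$. -/
theorem gammaPar_quantizedB {a c d A : ℝ} (b : ℝ) (hd1 : d ≠ 1) {k : ℕ}
    (hk : (k : ℝ) < tauPar a b c - sigmaPar a d A) :
    gammaPar b d (quantizedB a b c d A k) = tauPar a b c - sigmaPar a d A - k := by
  rw [gammaPar, muPar, four_mul_quantizedB a b c A hd1, sub_sub_cancel, Real.sqrt_sq_eq_abs,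
    abs_of_neg (by linarith)]
  ring

theorem sigmaPar_sub_add {a c d A : ℝ} (b : ℝ) (hd1 : d ≠ 1) {k : ℕ}
    (hk : (k : ℝ) < tauPar a b c - sigmaPar a d A) :
    sigmaPar a d A - tauPar a b c + gammaPar b d (quantizedB a b c d A k) = -k := by
  rw [gammaPar_quantizedB b hd1 hk]
  ring

theorem quantizedB_injOn (a b c A : ℝ) {d : ℝ} (hd1 : d ≠ 1) :
    Set.InjOn (quantizedB a b c d A) {k : ℕ | (k : ℝ) < tauPar a b c - sigmaPar a d A} := by
  intro k hk l hl h
  have h1 := gammaPar_quantizedB b hd1 hk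
  rw [h, gammaPar_quantizedB b hd1 hl] at h1
  exact_mod_cast (show (k : ℝ) = l by linarith)

/-- The break condition $\sigma-\tau+\gamma=-k$ determines $\mu+1$, hence $B$, and $\gamma>0$ gives
the bound on $k$. -/
theorem spectrumB_eq (a b c A : ℝ) {d : ℝ} (hd1 : d ≠ 1) :
    spectrumB a b c d A =
      quantizedB a b c d A '' {k : ℕ | (k : ℝ) < tauPar a b c - sigmaPar a d A} := by
  have hν : 0 ≤ nuPar a d A := Real.sqrt_nonneg _
  ext B
  constructor
  · rintro ⟨hB, hf⟩
    have hμ := neg_one_lt_muPar hB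
    obtain ⟨k, hk⟩ := (exists_summable_iff _ hμ hν).1 hf
    have hk' : (k : ℝ) < tauPar a b c - sigmaPar a d A := by
      unfold tauPar sigmaPar; linarith
    refine ⟨k, hk', ?_⟩
    have h1 := four_mul_quantizedB a b c A hd1 k
    have h2 := muPar_add_one_sq hB
    have h3 : 2 * (k + sigmaPar a d A - tauPar a b c) = -(muPar b d B + 1) := by
      unfold tauPar sigmaPar; linarith
    rw [h3, neg_sq, h2, sub_sub_cancel,
      div_left_inj' (sub_ne_zero.2 hd1.symm)] at h1
    linarith
  · rintro ⟨k, hk, rfl⟩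
    have hB := quantizedB_lt b hd1 hk
    exact ⟨hB, (exists_summable_iff _ (neg_one_lt_muPar hB) hν).2
      ⟨k, by have := sigmaPar_sub_add b hd1 hk; unfold sigmaPar tauPar gammaPar at this; linarith⟩⟩

theorem quantizedE_eq (a b c A : ℝ) {d : ℝ} (hd1 : d ≠ 1) (k : ℕ) :
    quantizedE a b c d A k = restrictedE a b c d A (quantizedB a b c d A k) := by
  have : 1 - d ≠ 0 := sub_ne_zero.2 hd1.symm
  rw [quantizedE, restrictedE, quantizedB]
  field_simp
  ring

/-- The closed form of the solution. -/
theorem ySol_eq {a c d A : ℝ} (b : ℝ) (hd1 : d ≠ 1) {k : ℕ}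
    (hk : (k : ℝ) < tauPar a b c - sigmaPar a d A) :
    ySol a b c d A k = fun x =>
      √(qSq k (sigmaPar a d A) (tauPar a b c) (gammaPar b d (quantizedB a b c d A k))) *
        kernelConst k (muPar b d (quantizedB a b c d A k)) (nuPar a d A) *
      (prefactor ((nuPar a d A + 1 - a) / 2) ((muPar b d (quantizedB a b c d A k) + 2 - b) / 2)
          (-c / 2) d x *
        (hypPoly k (k + muPar b d (quantizedB a b c d A k) + nuPar a d A + 2)
          (muPar b d (quantizedB a b c d A k) + 2)).eval (1 - x)) := by
  have hν : 0 ≤ nuPar a d A := Real.sqrt_nonneg _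
  have hμ := neg_one_lt_muPar (quantizedB_lt b hd1 hk)
  have h := sigmaPar_sub_add b hd1 hk
  have hz : zSq k (sigmaPar a d A) (tauPar a b c) =
      -(1 / 4) * (muPar b d (quantizedB a b c d A k) + 1) ^ 2 := by
    rw [zSq, show (k : ℝ) + sigmaPar a d A - tauPar a b c =
      -gammaPar b d (quantizedB a b c d A k) by linarith, gammaPar]
    ring
  funext x
  rw [ySol, mul_assoc, prefactor, ← sum_wilsonEnd_mul_phi hμ hν]
  congr 1
  symm
  -- The sum up to `N` really stops at `k`: up to there the coefficients are `wilsonEnd`, beyond it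
  -- they vanish.
  refine (Finset.sum_congr rfl fun n hn => ?_).trans (Finset.sum_subset
    (Finset.range_mono (Nat.succ_le_succ (Nat.le_floor hk.le))) fun n _ hn => ?_)
  · congr 1
    rw [hz]
    refine (wilson_end n hμ hν (show 0 ≤ |a + b + c - 1| / 2 by positivity) ?_).symm
    have h' : (nuPar a d A + 1) / 2 - |a + b + c - 1| / 2 +
      (muPar b d (quantizedB a b c d A k) + 1) / 2 = -k := h
    rw [h']
    exact poch_neg_nat_ne_zero (Nat.lt_succ_iff.1 (Finset.mem_range.1 hn))
  · rw [wilson_eq_zero, zero_mul]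
    rw [h]
    exact poch_neg_nat_eq_zero (by have := Finset.mem_range.not.1 hn; omega)

theorem ySol_isHeunSolution {a d A C D : ℝ} (b c : ℝ) (hd0 : d ≠ 0) (hd1 : d ≠ 1)
    (hA : 4 * A / d ≤ (1 - a) ^ 2) (hC : 4 * C = c * d * (1 - d) * (2 - c)) (hD : D = 0) {k : ℕ}
    (hk : (k : ℝ) < tauPar a b c - sigmaPar a d A) :
    IsHeunSolution a b c d A (quantizedB a b c d A k) C D (quantizedE a b c d A k)
      (ySol a b c d A k) := by
  have hB := quantizedB_lt b hd1 hk
  have hμ := neg_one_lt_muPar hB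
  have hν2 : nuPar a d A ^ 2 = (1 - a) ^ 2 - 4 * A / d := Real.sq_sqrt (sub_nonneg.2 hA)
  have hμ2 := muPar_add_one_sq hB
  have hd1' : 1 - d ≠ 0 := sub_ne_zero.2 hd1.symm
  have h := sigmaPar_sub_add b hd1 hk
  unfold sigmaPar tauPar gammaPar at h
  have hs := sq_abs (a + b + c - 1)
  rw [ySol_eq b hd1 hk, quantizedE_eq a b c A hd1]
  set B := quantizedB a b c d A k
  set μ := muPar b d B
  set ν := nuPar a d A
  have eA : d * (((ν + 1 - a) / 2) ^ 2 - (ν + 1 - a) / 2 * ν) = A := by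
    rw [show d * (((ν + 1 - a) / 2) ^ 2 - (ν + 1 - a) / 2 * ν) = d * ((1 - a) ^ 2 - ν ^ 2) / 4 by
      ring, hν2]
    field_simp
    ring
  have eB : (1 - d) * (((μ + 2 - b) / 2) ^ 2 - (μ + 2 - b) / 2 * (μ + 1)) = B := by
    rw [show (1 - d) * (((μ + 2 - b) / 2) ^ 2 - (μ + 2 - b) / 2 * (μ + 1)) =
      (1 - d) * ((1 - b) ^ 2 - (μ + 1) ^ 2) / 4 by ring, hμ2]
    field_simp
    ring
  have key := isHeunSolution_prefactor_mul (α := (ν + 1 - a) / 2) (β := (μ + 2 - b) / 2)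
    (δ := -c / 2) (μ := μ) (ν := ν) (d := d) k (√(qSq k (sigmaPar a d A) (tauPar a b c)
      (gammaPar b d B)) * kernelConst k μ ν) hμ (by
    -- With $s=a+b+c-1$ the exponents add up to $(\mu+\nu+2-s)/2$. By the quantization both products
    -- in the degree condition equal $(s^2-(\mu+\nu+2)^2)/4$.
    have hk' : (k : ℝ) = |a + b + c - 1| / 2 - (μ + ν + 2) / 2 := by linarith
    rw [hk']
    linear_combination 1 / 4 * hs)
  have eE : restrictedE a b c d A B = (((ν + 1 - a) / 2) ^ 2 - (ν + 1 - a) / 2 * ν) -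
      (((μ + 2 - b) / 2) ^ 2 - (μ + 2 - b) / 2 * (μ + 1)) + -c / 2 * (d * ((ν + 1 - 2 *
        ((ν + 1 - a) / 2)) + (μ + 2 - 2 * ((μ + 2 - b) / 2)) - 2 * (-c / 2) - 2) + 1 -
          (ν + 1 - 2 * ((ν + 1 - a) / 2)) + -c / 2) := by
    have eA' : A / d = ((ν + 1 - a) / 2) ^ 2 - (ν + 1 - a) / 2 * ν := by
      rw [← eA, mul_div_cancel_left₀ _ hd0]
    have eB' : B / (1 - d) = ((μ + 2 - b) / 2) ^ 2 - (μ + 2 - b) / 2 * (μ + 1) := by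
      rw [← eB, mul_div_cancel_left₀ _ hd1']
    rw [restrictedE, eA', eB']
    ring
  rw [← eE, eA, eB, show ν + 1 - 2 * ((ν + 1 - a) / 2) = a by ring,
    show μ + 2 - 2 * ((μ + 2 - b) / 2) = b by ring, show -2 * (-c / 2) = c by ring,
    show -(-c / 2) * (1 + -c / 2) * d * (1 - d) = C by linarith] at key
  rw [hD]
  exact key

end HeunRestricted

open HeunRestricted in
theorem mainTheorem2 (a b c d A C D : ℝ) (hd0 : d ≠ 0) (hd1 : d ≠ 1)
    (hA : 4 * A / d ≤ (1 - a) ^ 2) (hC : 4 * C = c * d * (1 - d) * (2 - c)) (hD : D = 0) :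
    -- the recursion is solved by the Wilson polynomials at `z² = -(μ + 1)² / 4`, with `W₀ = 1`;
    -- every square-summable solution is a multiple of this one
    (∀ B : ℝ, 4 * B / (1 - d) < (1 - b) ^ 2 →
      wilson 0 (-(1 / 4) * (muPar b d B + 1) ^ 2)
          (sigmaPar a d A) (tauPar a b c) (gammaPar b d B) = 1 ∧
      SolvesRecursion (muPar b d B) (nuPar a d A) (a + b + c - 1)
        (fun n => wilson n (-(1 / 4) * (muPar b d B + 1) ^ 2)
          (sigmaPar a d A) (tauPar a b c) (gammaPar b d B)) ∧
      ∀ f : ℕ → ℝ, SolvesRecursion (muPar b d B) (nuPar a d A) (a + b + c - 1) f →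
        Summable (fun n => f n ^ 2) →
        ∃ p : ℝ, ∀ n, f n = p * wilson n (-(1 / 4) * (muPar b d B + 1) ^ 2)
          (sigmaPar a d A) (tauPar a b c) (gammaPar b d B)) ∧
    -- the spectrum is discrete and finite
    spectrumB a b c d A =
      quantizedB a b c d A '' {k : ℕ | (k : ℝ) < tauPar a b c - sigmaPar a d A} ∧
    (spectrumB a b c d A).Finite ∧
    Set.InjOn (quantizedB a b c d A) {k : ℕ | (k : ℝ) < tauPar a b c - sigmaPar a d A} ∧
    -- the solution for a given `k`
    ∀ k : ℕ, (k : ℝ) < tauPar a b c - sigmaPar a d A →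
      4 * quantizedB a b c d A k / (1 - d) < (1 - b) ^ 2 ∧
      -(1 / 4) * (muPar b d (quantizedB a b c d A k) + 1) ^ 2 =
        zSq k (sigmaPar a d A) (tauPar a b c) ∧
      -- the coefficients vanish beyond `n = k`, where `k ≤ N`
      k ≤ sizeN a b c d A ∧
      (∀ n, k < n → wilson n (zSq k (sigmaPar a d A) (tauPar a b c))
        (sigmaPar a d A) (tauPar a b c) (gammaPar b d (quantizedB a b c d A k)) = 0) ∧
      -- `q²` is the discrete weight function of the Wilson polynomials
      (∀ j, j ≤ k → 0 < qSq j (sigmaPar a d A) (tauPar a b c) (gammaPar b d (quantizedB a b c d A k))) ∧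
      (∀ j, k < j → j ≤ sizeN a b c d A →
        qSq j (sigmaPar a d A) (tauPar a b c) (gammaPar b d (quantizedB a b c d A k)) = 0) ∧
      (∀ n m, n ≤ k → m ≤ k →
        ∑ j ∈ Finset.range (sizeN a b c d A + 1),
          qSq j (sigmaPar a d A) (tauPar a b c) (gammaPar b d (quantizedB a b c d A k)) *
            wilson n (zSq j (sigmaPar a d A) (tauPar a b c))
              (sigmaPar a d A) (tauPar a b c) (gammaPar b d (quantizedB a b c d A k)) *
            wilson m (zSq j (sigmaPar a d A) (tauPar a b c))
              (sigmaPar a d A) (tauPar a b c) (gammaPar b d (quantizedB a b c d A k)) =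
          if n = m then 1 else 0) ∧
      -- `y_k` is a nonzero solution of the Heun-type equation and an eigenfunction of `H`
      quantizedE a b c d A k = restrictedE a b c d A (quantizedB a b c d A k) ∧
      IsHeunSolution a b c d A (quantizedB a b c d A k) C D (quantizedE a b c d A k)
        (ySol a b c d A k) ∧
      (∀ x : ℝ, x ≠ 0 → x ≠ 1 → x ≠ d →
        heunH a b c d A (quantizedB a b c d A k) C D (ySol a b c d A k) x =
          quantizedE a b c d A k * ySol a b c d A k x) ∧
      ∃ x : ℝ, 0 < x ∧ x < 1 ∧ x ≠ d ∧ ySol a b c d A k x ≠ 0 := by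
  have hν : 0 ≤ nuPar a d A := Real.sqrt_nonneg _
  have hspec := spectrumB_eq a b c A hd1
  have hinj := quantizedB_injOn a b c A hd1
  refine ⟨fun B hB => ?_, hspec, ?_, hinj, fun k hk => ?_⟩
  · have hμ := neg_one_lt_muPar hB
    refine ⟨?_, wilson_solvesRecursion _ hμ hν, fun f hf hs =>
      ⟨f 0, eq_mul_wilson_of_summable hμ hν hf hs⟩⟩
    have h := wilson_end 0 hμ hν (show 0 ≤ |a + b + c - 1| / 2 by positivity) (by simp [poch_zero])
    rw [wilsonEnd_zero hμ hν] at h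
    exact h
  · rw [hspec]
    refine Set.Finite.image _ ((Set.finite_Iic ⌊tauPar a b c - sigmaPar a d A⌋₊).subset ?_)
    intro k hk
    exact Nat.le_floor (le_of_lt hk)
  · have hB := quantizedB_lt b hd1 hk
    have hμ := neg_one_lt_muPar hB
    have hg : 0 < gammaPar b d (quantizedB a b c d A k) := by unfold gammaPar; linarith
    have hσ : 1 / 2 ≤ sigmaPar a d A := by unfold sigmaPar; linarith
    have hσ' : 0 < sigmaPar a d A := by linarith
    have h := sigmaPar_sub_add b hd1 hk
    have hkN : k ≤ sizeN a b c d A := Nat.le_floor hk.le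
    have hy := ySol_eq b hd1 hk
    have hsol := ySol_isHeunSolution b c hd0 hd1 hA hC hD hk
    refine ⟨hB, ?_, hkN, fun n hn => wilson_eq_zero n ?_, fun j hj => qSq_pos hg hσ' h hj,
      fun j hj _ => qSq_eq_zero h hj, fun n m hn hm => wilson_orthonormal hg hσ h hkN hn hm,
      ?_, hsol, fun x h0 h1 hd => hsol.heunH_eq h0 h1 hd, ?_⟩
    · rw [zSq, show (k : ℝ) + sigmaPar a d A - tauPar a b c =
        -gammaPar b d (quantizedB a b c d A k) by linarith, gammaPar]
      ring
    · rw [h]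
      exact poch_neg_nat_eq_zero hn
    · exact quantizedE_eq a b c A hd1 k
    · obtain ⟨x, h0, h1, hd, hne⟩ := exists_eval_ne_zero (P := hypPoly k
        (k + muPar b d (quantizedB a b c d A k) + nuPar a d A + 2)
        (muPar b d (quantizedB a b c d A k) + 2)) (by rw [hypPoly_eval_zero]; exact one_ne_zero) d
      refine ⟨x, h0, h1, hd, ?_⟩
      have hq := Real.sqrt_pos.2 (qSq_pos hg hσ' h le_rfl)
      have hK := kernelConst_pos hμ hν k
      have a0 : 0 < |x| := abs_pos.2 h0.ne'
      have a1 : 0 < |x - 1| := abs_pos.2 (sub_ne_zero.2 h1.ne)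
      have a2 : 0 < |x - d| := abs_pos.2 (sub_ne_zero.2 hd)
      rw [hy]
      simp only [prefactor]
      refine mul_ne_zero (mul_pos hq hK).ne' (mul_ne_zero ?_ hne)
      positivity
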